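/- **Setting.** For a finite simple graph $G=(V_G,E_G)$, $p\in(0,1)$ and $q>0$, the random-cluster measure with boundary condition $\xi$ (a partition of a set of boundary vertices) gives $A\subseteq E_G$ probability proportional to $p^{|A|}(1-p)^{|E_G\setminus A|}q^{c^\xi(A)}$, where $c^\xi(A)$ is the number of connected components of $(V_G,A)$ when the vertices in each class of $\xi$ are regarded as connected. The heat-bath edge dynamics picks an edge uniformly at random and resamples its state from the conditional distribution given all the other edges; $\mathsf{gap}$ is its absolute spectral gap $1-\max\{|\lambda_2|,|\lambda_{\min}|\}$. The chain on $G$ itself, with no boundary condition, is denoted $\mathcal M$. Let $T_h$ be the complete binary tree of height $h$. For $1\le \ell\le h$ let $B_1,\dots,B_{2^{h-\ell}}$ be the full subtrees of height $\ell$ that contain the leaves of $T_h$, and let $a_i,b_i$ be the two leftmost leaves of $B_i$ and $c_i$ their parent. Let $\hat G$ be obtained from $G$ by replacing every edge $\{u,v\}$ by a path $u,r_{uv},v$ of length 2. If $|E_G|<2^{h-\ell}$, assign to the edges of $G$ distinct indices $i$ and map, for an edge $\{u,v\}$ with index $i$, $u\mapsto a_i$, $r_{uv}\mapsto c_i$,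 $v\mapsto b_i$ (so a vertex of $G$ is mapped to as many leaves as its degree). The boundary condition $\xi(\hat G)$ of $T_h$ wires together all leaves that correspond to the same vertex of $\hat G$ and leaves all other leaves free. $\mathcal M(T_h)$ denotes the heat-bath edge dynamics on $T_h$ with boundary condition $\xi(\hat G)$. **Theorem.** Let $q>2$, $c>0$ and $\gamma>0$ be constants. There are constants $\delta>0$ and $c'>0$, depending only on $q$, $c$ and $\gamma$, such that the following holds for every finite graph $G$, all $p,\hat p\in(0,1)$ with $$p=\frac{\hat p^2}{\hat p^2+2\hat p(1-\hat p)+(1-\hat p)^2q},$$ and all integers $1\le\ell\le h$. If $$\mathsf{gap}(\mathcal M,p,q)\le e^{-c|V_G|},\qquad e^{-\gamma|V_G|}\le\hat p\le\tfrac12,\qquad |E_G|\,\hat p^{\,\ell-1}<\delta|V_G|,\qquad |E_G|<2^{h-\ell},$$ then a mapping as above exists, and for every such mapping, under the boundary condition $\xi(\hat G)$ that it induces, $$\mathsf{gap}(\mathcal M(T_h),\hat p,q)\le e^{-c'|V_G|}.$$ -/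

import Mathlib

/-- The absolute spectral gap `1 - max {|λ₂|, |λ_N|}` of a reversible transition matrix with
eigenvalues `1 = λ₁ ≥ λ₂ ≥ ⋯ ≥ λ_N ≥ -1`, counted with multiplicity: the eigenvalue `1` takes part
in the maximum only if it is a multiple one. (The gap is `1` if there is no other eigenvalue.) -/
noncomputable def absoluteSpectralGap {Ω : Type*} [Fintype Ω] (P : Matrix Ω Ω ℝ) : ℝ :=
  1 - sSup {r : ℝ | ∃ μ : ℝ, Module.End.HasEigenvalue P.mulVecLin μ ∧
    (μ = 1 → 2 ≤ Module.finrank ℝ (Module.End.eigenspace P.mulVecLin 1)) ∧ r = |μ|}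

namespace RandomCluster

variable {V : Type*} [Fintype V] (G : SimpleGraph V)

/-- Random-cluster configurations are subsets of the edge set. -/
abbrev Config {V : Type*} (G : SimpleGraph V) : Type _ := Set G.edgeSet

/-- The graph formed by the open edges together with the connections given by the boundary
condition `ξ`. A boundary condition is a partition of the boundary vertices; it is encoded as an
equivalence relation on all vertices, those outside the boundary being alone in their class. The
free boundary condition is `⊥`. -/
def openGraph {V : Type*} (G : SimpleGraph V) (ξ : Setoid V) (A : Config G) : SimpleGraph V :=
  SimpleGraph.fromEdgeSet (Subtype.val '' A) ⊔ SimpleGraph.fromRel (fun x y => ξ x y)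

/-- The number of connected components of `(V, A)`, taking into account the connections in `ξ`. -/
noncomputable def numComponents {V : Type*} (G : SimpleGraph V) (ξ : Setoid V) (A : Config G) : ℕ :=
  Nat.card (openGraph G ξ A).ConnectedComponent

/-- The weight `p^|A| (1 - p)^|E \ A| q^c(A)`. -/
noncomputable def weight {V : Type*} (G : SimpleGraph V) (ξ : Setoid V) (p q : ℝ)
    (A : Config G) : ℝ :=
  p ^ A.ncard * (1 - p) ^ Aᶜ.ncard * q ^ numComponents G ξ A

open scoped Classical in
/-- The random-cluster distribution with boundary condition `ξ`. -/
noncomputable def measure (ξ : Setoid V) (p q : ℝ) (A : Config G) : ℝ :=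
  weight G ξ p q A / ∑ B : Config G, weight G ξ p q B

open scoped Classical in
/-- The heat-bath update of the set of edges `U`: the configuration on `U` is resampled from its
conditional distribution given the configuration off `U`. -/
noncomputable def heatBathUpdate (ξ : Setoid V) (p q : ℝ) (U : Set G.edgeSet) :
    Matrix (Config G) (Config G) ℝ :=
  fun A B =>
    if B \ U = A \ U then
      measure G ξ p q B / ∑ C : Config G, if C \ U = A \ U then measure G ξ p q C else 0
    else 0

open scoped Classical in
/-- The transition matrix of the heat-bath edge dynamics: an edge is chosen uniformly at random and
undergoes a heat-bath update. -/
noncomputable def edgeDynamics (ξ : Setoid V) (p q : ℝ) : Matrix (Config G) (Config G) ℝ :=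
  fun A B => (∑ e : G.edgeSet, heatBathUpdate G ξ p q {e} A B) / (Nat.card G.edgeSet : ℝ)

open scoped Classical in
/-- The absolute spectral gap of the heat-bath edge dynamics on `G` with parameters `p`, `q` and
boundary condition `ξ`. -/
noncomputable def edgeGap (ξ : Setoid V) (p q : ℝ) : ℝ :=
  absoluteSpectralGap (edgeDynamics G ξ p q)

end RandomCluster

/-- The vertices of the complete binary tree of height `h`, numbered level by level from left to
right: `1` is the root, and `2 * v` and `2 * v + 1` are the left and right child of `v`. The leaves
are, from left to right, `2 ^ h, 2 ^ h + 1, …, 2 ^ (h + 1) - 1`. -/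
abbrev TreeVertex (h : ℕ) : Type := ↥(Finset.Ico 1 (2 ^ (h + 1)))

/-- The complete binary tree of height `h`: every vertex except the root is adjacent to its
parent. -/
def binaryTree (h : ℕ) : SimpleGraph (TreeVertex h) :=
  SimpleGraph.fromRel (fun u v => (v : ℕ) / 2 = u)

/-- A way to place the graph `G` on the complete binary tree of height `h`, whose leaves are
divided, from left to right, into the `2 ^ (h - ℓ)` groups formed by the `2 ^ ℓ` leaves of the full
subtrees of height `ℓ`. Every edge `{u, v}` of `G` has a subtree `block` of its own, and its
endpoints are put in an order `(left, right)`. In the subdivision of `G`, where the edge `{u, v}` is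
replaced by a path `u, r, v`, the vertices `u` and `v` of this path go to the two leftmost leaves
of the subtree, and the middle vertex `r` goes to their parent. -/
structure TreeEmbedding {V : Type*} (G : SimpleGraph V) (h ℓ : ℕ) where
  block : G.edgeSet ↪ Fin (2 ^ (h - ℓ))
  left : G.edgeSet → V
  right : G.edgeSet → V
  ends : ∀ e : G.edgeSet, s(left e, right e) = (e : Sym2 V)

namespace TreeEmbedding

variable {V : Type*} {G : SimpleGraph V} {h ℓ : ℕ}

/-- The vertex `x` of the tree is a leaf that carries the vertex `v` of `G`: it is the leftmost or
the second leaf of the subtree of an edge with `v` as its left or its right end, respectively. -/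
def Carries (φ : TreeEmbedding G h ℓ) (x : TreeVertex h) (v : V) : Prop :=
  ∃ e : G.edgeSet,
    ((x : ℕ) = 2 ^ h + φ.block e * 2 ^ ℓ ∧ v = φ.left e) ∨
    ((x : ℕ) = 2 ^ h + φ.block e * 2 ^ ℓ + 1 ∧ v = φ.right e)

theorem Carries.unique (φ : TreeEmbedding G h ℓ) (hℓ : 0 < ℓ) {x : TreeVertex h} {v w : V}
    (hv : φ.Carries x v) (hw : φ.Carries x w) : v = w := by
  obtain ⟨k, rfl⟩ : ∃ k, ℓ = k + 1 := ⟨ℓ - 1, by omega⟩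
  have key : ∀ e f : G.edgeSet,
      (φ.block e : ℕ) * 2 ^ (k + 1) = φ.block f * 2 ^ (k + 1) → e = f := fun e f hef =>
    φ.block.injective (Fin.ext (Nat.eq_of_mul_eq_mul_right (by positivity) hef))
  have par : ∀ e f : G.edgeSet,
      (φ.block e : ℕ) * 2 ^ (k + 1) ≠ φ.block f * 2 ^ (k + 1) + 1 := by
    intro e f hef
    rw [pow_succ, ← mul_assoc, ← mul_assoc] at hef
    omega
  obtain ⟨e, ⟨he, rfl⟩ | ⟨he, rfl⟩⟩ := hv <;> obtain ⟨f, ⟨hf, rfl⟩ | ⟨hf, rfl⟩⟩ := hw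
  · rw [key e f (by omega)]
  · exact absurd (by omega) (par e f)
  · exact absurd (by omega) (par f e)
  · rw [key e f (by omega)]

/-- The boundary condition of the embedding: leaves that carry the same vertex of `G` are wired
together, and all other leaves are free. -/
def boundary (φ : TreeEmbedding G h ℓ) (hℓ : 0 < ℓ) : Setoid (TreeVertex h) where
  r x y := x = y ∨ ∃ v, φ.Carries x v ∧ φ.Carries y v
  iseqv :=
    { refl := fun _ => Or.inl rfl
      symm := by
        rintro x y (rfl | ⟨v, hx, hy⟩)
        · exact Or.inl rfl
        · exact Or.inr ⟨v, hy, hx⟩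
      trans := by
        rintro x y z (rfl | ⟨v, hx, hy⟩) (rfl | ⟨w, hy', hz⟩)
        · exact Or.inl rfl
        · exact Or.inr ⟨w, hy', hz⟩
        · exact Or.inr ⟨v, hx, hy⟩
        · obtain rfl := Carries.unique φ hℓ hy hy'
          exact Or.inr ⟨v, hx, hz⟩ }

end TreeEmbedding

/-! A tree configuration is projected to `G` by declaring an edge of `G` open when both of its
halves, the two leaf edges of its block, are open. If only leaf edges could be open, the wiring
would reproduce the random-cluster model on the subdivision of `G`, and summing out the middle
vertices would give exactly the model on `G`: the relation between `p` and `p'` is this series law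
(`numComponents_leafEdges`, `sum_prod_halvesWeight`).

The other tree edges perturb this only slightly. An open one that merges two components contributes
a factor `1 / q`, just as an independent edge would. The open edges that fail to merge anything
number at most the blocks with a fully open stem, the stem being the `ℓ - 1` edges from the parent
of the two wired leaves up to the block root: a cycle through the upper tree has to enter and leave
blocks along such stems (`numComponents_add_le`). Hence the tree weight lies between a product form
and the same form times `q ^ k`, with `k` the number of open stems. In the product form a given stem
is open with probability at most `p' ^ (ℓ - 1)`, independently of the other stems, so the
exponential moment is at most `M = (1 + (q - 1) * p' ^ (ℓ - 1)) ^ |E|` (`sum_set_prod_stems_le`),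
and the projected measure agrees with that of `G` up to a constant and a factor `M`
(`exists_comparison`).

Such a comparison transfers slow mixing. Heat-bath chains are positive semidefinite, so a small gap
on `G` is witnessed by a mean-zero `f` with small Rayleigh quotient. Composed with the projection
and recentred, `f` is a test function on the tree, where a leaf edge influences one edge of `G` and
any other edge none; the gap grows by a factor of at most `M` (`edgeGap_le_of_comparison`). The
bound on `|E| * p' ^ (ℓ - 1)` keeps `M` below `exp (c |V| / 2)`, half of the available exponent. -/

/-! ### Spectral gap and Rayleigh quotients -/

theorem Matrix.exists_eigenvalue_ge_of_rayleigh {Ω : Type*} [Fintype Ω] (T : Matrix Ω Ω ℝ)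
    (hT : ∀ x y, T x y = T y x) (κ : ℝ) (v : Ω → ℝ) (hv : v ≠ 0)
    (h : κ * ∑ x, v x ^ 2 ≤ ∑ x, v x * T.mulVec v x) :
    ∃ μ : ℝ, κ ≤ μ ∧ ∃ u : Ω → ℝ, u ≠ 0 ∧ T.mulVec u = μ • u := by
  classical
  have hH : (κ • (1 : Matrix Ω Ω ℝ) - T).IsHermitian := by
    ext i j
    simp only [Matrix.conjTranspose_apply, Matrix.sub_apply, Matrix.smul_apply, star_trivial,
      hT i j, Matrix.one_apply, eq_comm]
  -- Were all eigenvalues of `κ - T` positive, the matrix would be positive definite, against its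
  -- value at `v`.
  have hneg : ¬ ∀ i, 0 < hH.eigenvalues i := by
    intro hpos
    have hpd := hH.posDef_iff_eigenvalues_pos.2 hpos
    have := hpd.dotProduct_mulVec_pos hv
    simp only [star_trivial, Matrix.sub_mulVec, Matrix.smul_mulVec, Matrix.one_mulVec,
      dotProduct_sub, dotProduct_smul, smul_eq_mul] at this
    simp only [dotProduct, ← pow_two] at this
    linarith
  push Not at hneg
  obtain ⟨i, hi⟩ := hneg
  refine ⟨κ - hH.eigenvalues i, by linarith, hH.eigenvectorBasis i, ?_, ?_⟩
  · intro h0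
    apply hH.eigenvectorBasis.toBasis.ne_zero i
    ext j
    simpa using congrFun h0 j
  · have := hH.mulVec_eigenvectorBasis i
    rw [Matrix.sub_mulVec, Matrix.smul_mulVec, Matrix.one_mulVec] at this
    rw [sub_smul, ← this]
    abel

section Gap

variable {Ω : Type*} [Fintype Ω] (P : Matrix Ω Ω ℝ)

theorem finite_gapSet : {r : ℝ | ∃ μ : ℝ, Module.End.HasEigenvalue P.mulVecLin μ ∧
    (μ = 1 → 2 ≤ Module.finrank ℝ (Module.End.eigenspace P.mulVecLin 1)) ∧ r = |μ|}.Finite := by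
  have hfin : {μ : ℝ | Module.End.HasEigenvalue P.mulVecLin μ}.Finite :=
    Module.End.finite_hasEigenvalue P.mulVecLin
  refine (hfin.image abs).subset ?_
  rintro r ⟨μ, hμ, -, rfl⟩
  exact ⟨μ, hμ, rfl⟩

theorem absoluteSpectralGap_le_one : absoluteSpectralGap P ≤ 1 := by
  unfold absoluteSpectralGap
  have : 0 ≤ sSup {r : ℝ | ∃ μ : ℝ, Module.End.HasEigenvalue P.mulVecLin μ ∧
      (μ = 1 → 2 ≤ Module.finrank ℝ (Module.End.eigenspace P.mulVecLin 1)) ∧ r = |μ|} := by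
    refine Real.sSup_nonneg ?_
    rintro r ⟨μ, -, -, rfl⟩
    exact abs_nonneg μ
  linarith

/-- The only delicate case is `μ = 1`: a nonzero function of mean zero is independent of the
constants, so the eigenvalue `1` is multiple and does count in the gap. -/
theorem absoluteSpectralGap_le_of_eigenvector (hP : P.mulVec (fun _ => 1) = fun _ => 1)
    (w : Ω → ℝ) (hw : ∑ x, w x ≠ 0) (μ : ℝ) (hμ : 0 ≤ μ) (g : Ω → ℝ) (hg : g ≠ 0)
    (hg0 : ∑ x, w x * g x = 0) (hPg : P.mulVec g = μ • g) :
    absoluteSpectralGap P ≤ 1 - μ := by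
  unfold absoluteSpectralGap
  refine sub_le_sub_left ?_ _
  refine le_csSup (finite_gapSet P).bddAbove ⟨μ, ?_, ?_, (abs_of_nonneg hμ).symm⟩
  · exact Module.End.hasEigenvalue_of_hasEigenvector
      (Module.End.hasEigenvector_iff.2 ⟨Module.End.mem_eigenspace_iff.2 hPg, hg⟩)
  · rintro rfl
    have hmem1 : (fun _ => 1 : Ω → ℝ) ∈ Module.End.eigenspace P.mulVecLin 1 :=
      Module.End.mem_eigenspace_iff.2 (by simpa using hP)
    have hmemg : g ∈ Module.End.eigenspace P.mulVecLin 1 := Module.End.mem_eigenspace_iff.2 hPg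
    have hli : LinearIndependent ℝ
        ![(⟨_, hmem1⟩ : Module.End.eigenspace P.mulVecLin 1), ⟨g, hmemg⟩] := by
      rw [LinearIndependent.pair_iff]
      intro s t hst
      have hst' : ∀ x, s + t * g x = 0 := fun x => by
        simpa using congrFun (congrArg Subtype.val hst) x
      have hs : s = 0 := by
        have h1 : ∑ x, w x * (s + t * g x) = s * ∑ x, w x + t * ∑ x, w x * g x := by
          rw [Finset.mul_sum, Finset.mul_sum, ← Finset.sum_add_distrib]
          exact Finset.sum_congr rfl fun x _ => by ring
        simp only [hst', mul_zero, Finset.sum_const_zero, hg0, add_zero] at h1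
        exact (mul_eq_zero.1 h1.symm).resolve_right hw
      refine ⟨hs, ?_⟩
      obtain ⟨x, hx⟩ := Function.ne_iff.1 hg
      have := hst' x
      rw [hs, zero_add] at this
      exact (mul_eq_zero.1 this).resolve_right hx
    simpa using hli.fintype_card_le_finrank

/-- A mean-zero test function bounds the absolute spectral gap of a reversible chain. -/
theorem absoluteSpectralGap_le_of_rayleigh (hP : P.mulVec (fun _ => 1) = fun _ => 1)
    (w : Ω → ℝ) (hw : ∀ x, 0 < w x) (hw1 : ∑ x, w x = 1)
    (hrev : ∀ x y, w x * P x y = w y * P y x) (ε : ℝ) (f : Ω → ℝ) (hf : f ≠ 0)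
    (hf0 : ∑ x, w x * f x = 0)
    (h : ∑ x, w x * (f x * (f x - P.mulVec f x)) ≤ ε * ∑ x, w x * f x ^ 2) :
    absoluteSpectralGap P ≤ ε := by
  rcases le_or_gt 1 ε with hε | hε
  · exact (absoluteSpectralGap_le_one P).trans hε
  have hs : ∀ x, 0 < √(w x) := fun x => Real.sqrt_pos.2 (hw x)
  have hss : ∀ x, √(w x) * √(w x) = w x := fun x => Real.mul_self_sqrt (hw x).le
  -- Conjugation by `√w` makes the reversible chain symmetric; subtracting the rank-one term removes
  -- the constants, so that the top eigenvalue of `T` concerns mean-zero functions.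
  set T : Matrix Ω Ω ℝ := fun x y => √(w x) * P x y / √(w y) - √(w x) * √(w y) with hTdef
  have hT : ∀ x y, T x y = T y x := by
    intro x y
    have h1 : √(w x) * P x y / √(w y) = √(w y) * P y x / √(w x) := by
      rw [div_eq_div_iff (hs y).ne' (hs x).ne']
      linear_combination hrev x y + P x y * hss x - P y x * hss y
    simp only [hTdef, h1]
    ring
  have hTv : ∀ g : Ω → ℝ, ∀ x, T.mulVec (fun y => √(w y) * g y) x
      = √(w x) * (P.mulVec g x - ∑ y, w y * g y) := by
    intro g x
    simp only [Matrix.mulVec, dotProduct, hTdef]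
    rw [← Finset.sum_sub_distrib, Finset.mul_sum]
    refine Finset.sum_congr rfl fun y _ => ?_
    have := (hs y).ne'
    field_simp
    linear_combination (-(√(w x) * g y)) * hss y
  obtain ⟨μ, hμ, u, hu, hTu⟩ := T.exists_eigenvalue_ge_of_rayleigh hT (1 - ε)
    (fun y => √(w y) * f y) (by
      obtain ⟨x, hx⟩ := Function.ne_iff.1 hf
      exact Function.ne_iff.2 ⟨x, mul_ne_zero (hs x).ne' hx⟩) (by
      simp only [hTv, hf0, sub_zero]
      have e1 : ∀ x, (√(w x) * f x) ^ 2 = w x * f x ^ 2 := fun x => by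
        rw [mul_pow, pow_two (√(w x)), hss]
      have e2 : ∀ x, √(w x) * f x * (√(w x) * P.mulVec f x) = w x * (f x * P.mulVec f x) :=
        fun x => by linear_combination (f x * P.mulVec f x) * hss x
      simp only [e1, e2]
      have e3 : ∑ x, w x * (f x * (f x - P.mulVec f x))
          = ∑ x, w x * f x ^ 2 - ∑ x, w x * (f x * P.mulVec f x) := by
        rw [← Finset.sum_sub_distrib]
        exact Finset.sum_congr rfl fun x _ => by ring
      linarith)
  have hμ0 : 0 < μ := by linarith
  set g : Ω → ℝ := fun x => u x / √(w x) with hgdef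
  have hug : u = fun x => √(w x) * g x := by
    funext x
    rw [hgdef]
    field_simp [(hs x).ne']
  have key : ∀ x, P.mulVec g x - ∑ y, w y * g y = μ * g x := by
    intro x
    have h1 := congrFun hTu x
    rw [hug, hTv] at h1
    simp only [Pi.smul_apply, smul_eq_mul] at h1
    have h2 : √(w x) * (P.mulVec g x - ∑ y, w y * g y) = √(w x) * (μ * g x) := by
      rw [h1]; ring
    exact mul_left_cancel₀ (hs x).ne' h2
  have hPinv : ∑ x, w x * P.mulVec g x = ∑ x, w x * g x := by
    simp only [Matrix.mulVec, dotProduct, Finset.mul_sum]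
    rw [Finset.sum_comm]
    refine Finset.sum_congr rfl fun y _ => ?_
    have h1 := congrFun hP y
    simp only [Matrix.mulVec, dotProduct, mul_one] at h1
    calc ∑ x, w x * (P x y * g y) = ∑ x, w y * g y * P y x :=
          Finset.sum_congr rfl fun x _ => by linear_combination g y * hrev x y
      _ = w y * g y := by rw [← Finset.mul_sum, h1, mul_one]
  -- In the mean of `key` the left side vanishes by stationarity, and `μ > 0` then forces mean zero.
  have hg0 : ∑ x, w x * g x = 0 := by
    have h1 : ∑ x, w x * (P.mulVec g x - ∑ y, w y * g y) = μ * ∑ x, w x * g x := by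
      rw [Finset.mul_sum]
      exact Finset.sum_congr rfl fun x _ => by rw [key]; ring
    simp only [mul_sub, Finset.sum_sub_distrib, ← Finset.sum_mul, hw1, one_mul, hPinv,
      sub_self] at h1
    exact (mul_eq_zero.1 h1.symm).resolve_left hμ0.ne'
  have hg : g ≠ 0 := by
    intro h0
    apply hu
    rw [hug, h0]
    funext x
    simp
  refine (absoluteSpectralGap_le_of_eigenvector P hP w (by simp [hw1]) μ hμ0.le g hg hg0
    ?_).trans (by linarith)
  funext x
  have := key x
  rw [hg0, sub_zero] at this
  simpa using this

/-- A small absolute spectral gap of a reversible chain with positive semidefinite transition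
matrix is witnessed by a mean-zero function. -/
theorem exists_rayleigh_of_absoluteSpectralGap_le (hP : P.mulVec (fun _ => 1) = fun _ => 1)
    (w : Ω → ℝ) (hw : ∀ x, 0 < w x) (hrev : ∀ x y, w x * P x y = w y * P y x)
    (hpsd : ∀ f : Ω → ℝ, 0 ≤ ∑ x, w x * (f x * P.mulVec f x)) (ε : ℝ) (hε : ε < 1)
    (h : absoluteSpectralGap P ≤ ε) :
    ∃ f : Ω → ℝ, f ≠ 0 ∧ ∑ x, w x * f x = 0 ∧
      ∑ x, w x * (f x * (f x - P.mulVec f x)) ≤ ε * ∑ x, w x * f x ^ 2 := by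
  set R : Set ℝ := {r : ℝ | ∃ μ : ℝ, Module.End.HasEigenvalue P.mulVecLin μ ∧
    (μ = 1 → 2 ≤ Module.finrank ℝ (Module.End.eigenspace P.mulVecLin 1)) ∧ r = |μ|} with hR
  have hgap : 1 - sSup R ≤ ε := h
  -- The supremum of the empty set is `0` by convention, which would make the gap `1 > ε`.
  have hne : R.Nonempty := by
    by_contra hne
    rw [Set.not_nonempty_iff_eq_empty.1 hne, Real.sSup_empty] at hgap
    linarith
  obtain ⟨μ, hμ, hμ1, hμs⟩ := hne.csSup_mem (finite_gapSet P)
  rw [hμs] at hgap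
  have hpos : ∀ f : Ω → ℝ, f ≠ 0 → 0 < ∑ x, w x * f x ^ 2 := by
    intro f hf
    obtain ⟨x, hx⟩ := Function.ne_iff.1 hf
    exact Finset.sum_pos' (fun y _ => mul_nonneg (hw y).le (sq_nonneg _))
      ⟨x, Finset.mem_univ x, mul_pos (hw x) (sq_pos_iff.2 hx)⟩
  have main : ∀ f : Ω → ℝ, P.mulVec f = μ • f → f ≠ 0 →
      ∑ x, w x * (f x * (f x - P.mulVec f x)) ≤ ε * ∑ x, w x * f x ^ 2 := by
    intro f hf hf0
    have h1 : ∑ x, w x * (f x * P.mulVec f x) = μ * ∑ x, w x * f x ^ 2 := by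
      rw [hf, Finset.mul_sum]
      exact Finset.sum_congr rfl fun x _ => by
        simp only [Pi.smul_apply, smul_eq_mul]; ring
    -- Positive semidefiniteness excludes a gap that is caused by a negative eigenvalue, about which
    -- the Rayleigh quotient would say nothing.
    have hμ0 : 0 ≤ μ := by
      have := hpsd f
      rw [h1] at this
      exact nonneg_of_mul_nonneg_left this (hpos f hf0)
    rw [abs_of_nonneg hμ0] at hgap
    have e3 : ∑ x, w x * (f x * (f x - P.mulVec f x))
        = ∑ x, w x * f x ^ 2 - ∑ x, w x * (f x * P.mulVec f x) := by
      rw [← Finset.sum_sub_distrib]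
      exact Finset.sum_congr rfl fun x _ => by ring
    rw [e3, h1]
    nlinarith [hpos f hf0]
  rcases eq_or_ne μ 1 with h1 | h1
  -- The eigenvalue `1` counts only if multiple, and the mean, a single linear condition, has a
  -- nontrivial kernel on an eigenspace of dimension at least two.
  · let φ : (Ω → ℝ) →ₗ[ℝ] ℝ := ∑ x, w x • LinearMap.proj x
    have hφ : ∀ f, φ f = ∑ x, w x * f x := by
      intro f
      simp [φ]
    have hker : (φ.domRestrict (Module.End.eigenspace P.mulVecLin 1)).ker ≠ ⊥ := by
      refine LinearMap.ker_ne_bot_of_finrank_lt ?_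
      have := hμ1 h1
      rw [Module.finrank_self]
      omega
    obtain ⟨⟨f, hf⟩, hfk, hfne⟩ := Submodule.exists_mem_ne_zero_of_ne_bot hker
    have hf0 : f ≠ 0 := fun h0 => hfne (Subtype.ext h0)
    refine ⟨f, hf0, ?_, main f ?_ hf0⟩
    · rw [← hφ]
      exact hfk
    · rw [h1]
      exact Module.End.mem_eigenspace_iff.1 hf
  · obtain ⟨f, hf⟩ := hμ.exists_hasEigenvector
    have hPf : P.mulVec f = μ • f := hf.apply_eq_smul
    refine ⟨f, hf.2, ?_, main f hPf hf.2⟩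
    have hPinv : ∑ x, w x * P.mulVec f x = ∑ x, w x * f x := by
      simp only [Matrix.mulVec, dotProduct, Finset.mul_sum]
      rw [Finset.sum_comm]
      refine Finset.sum_congr rfl fun y _ => ?_
      have h1 := congrFun hP y
      simp only [Matrix.mulVec, dotProduct, mul_one] at h1
      calc ∑ x, w x * (P x y * f y) = ∑ x, w y * f y * P y x :=
            Finset.sum_congr rfl fun x _ => by linear_combination f y * hrev x y
        _ = w y * f y := by rw [← Finset.mul_sum, h1, mul_one]
    have h2 : ∑ x, w x * P.mulVec f x = μ * ∑ x, w x * f x := by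
      rw [hPf, Finset.mul_sum]
      exact Finset.sum_congr rfl fun x _ => by
        simp only [Pi.smul_apply, smul_eq_mul]; ring
    rw [h2] at hPinv
    have h3 : (μ - 1) * ∑ x, w x * f x = 0 := by linarith
    exact (mul_eq_zero.1 h3).resolve_left (sub_ne_zero.2 h1)

end Gap

/-! ### Heat-bath updates as conditional expectations -/

namespace RandomCluster

section HeatBath

variable {V : Type*} [Fintype V] (G : SimpleGraph V) (ξ : Setoid V) {p q : ℝ}

theorem weight_pos {V : Type*} (G : SimpleGraph V) (ξ : Setoid V) (hp : 0 < p) (hp1 : p < 1)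
    (hq : 0 < q) (A : Config G) :
    0 < weight G ξ p q A := by
  have : 0 < 1 - p := by linarith
  unfold weight
  positivity

open scoped Classical in
theorem sum_weight_pos (hp : 0 < p) (hp1 : p < 1) (hq : 0 < q) :
    0 < ∑ B : Config G, weight G ξ p q B :=
  Finset.sum_pos (fun B _ => weight_pos G ξ hp hp1 hq B) Finset.univ_nonempty

theorem measure_pos (hp : 0 < p) (hp1 : p < 1) (hq : 0 < q) (A : Config G) :
    0 < measure G ξ p q A :=
  div_pos (weight_pos G ξ hp hp1 hq A) (sum_weight_pos G ξ hp hp1 hq)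

open scoped Classical in
theorem sum_measure (hp : 0 < p) (hp1 : p < 1) (hq : 0 < q) :
    ∑ A : Config G, measure G ξ p q A = 1 := by
  simp only [measure, ← Finset.sum_div]
  exact div_self (sum_weight_pos G ξ hp hp1 hq).ne'

open scoped Classical in
theorem heatBathUpdate_denom_pos (hp : 0 < p) (hp1 : p < 1) (hq : 0 < q) (U : Set G.edgeSet)
    (A : Config G) : 0 < ∑ C : Config G, if C \ U = A \ U then measure G ξ p q C else 0 := by
  refine Finset.sum_pos' (fun C _ => ?_) ⟨A, Finset.mem_univ A, ?_⟩
  · split_ifs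
    · exact (measure_pos G ξ hp hp1 hq C).le
    · exact le_rfl
  · rw [if_pos rfl]
    exact measure_pos G ξ hp hp1 hq A

theorem heatBathUpdate_congr (U : Set G.edgeSet) {A A' : Config G} (h : A \ U = A' \ U)
    (B : Config G) : heatBathUpdate G ξ p q U A B = heatBathUpdate G ξ p q U A' B := by
  simp only [heatBathUpdate, h]

theorem heatBathUpdate_eq_zero (U : Set G.edgeSet) {A B : Config G} (h : B \ U ≠ A \ U) :
    heatBathUpdate G ξ p q U A B = 0 := by
  simp only [heatBathUpdate, if_neg h]

open scoped Classical in
theorem sum_heatBathUpdate (hp : 0 < p) (hp1 : p < 1) (hq : 0 < q) (U : Set G.edgeSet)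
    (A : Config G) : ∑ B : Config G, heatBathUpdate G ξ p q U A B = 1 := by
  rw [← div_self (heatBathUpdate_denom_pos G ξ hp hp1 hq U A).ne', Finset.sum_div]
  refine Finset.sum_congr rfl fun B _ => ?_
  simp only [heatBathUpdate]
  split_ifs <;> simp

theorem heatBathUpdate_reversible (U : Set G.edgeSet) (A B : Config G) :
    measure G ξ p q A * heatBathUpdate G ξ p q U A B =
      measure G ξ p q B * heatBathUpdate G ξ p q U B A := by
  by_cases h : B \ U = A \ U
  · simp only [heatBathUpdate, h, if_true]
    ring
  · rw [heatBathUpdate_eq_zero G ξ U h, heatBathUpdate_eq_zero G ξ U (Ne.symm h)]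
    simp

/-- A function is invariant under the update of `U` if it does not depend on `U`. -/
theorem heatBathUpdate_mulVec_of_invariant [Fintype (Config G)] (hp : 0 < p) (hp1 : p < 1)
    (hq : 0 < q) (U : Set G.edgeSet) (g : Config G → ℝ)
    (hg : ∀ A B : Config G, A \ U = B \ U → g A = g B) :
    (heatBathUpdate G ξ p q U).mulVec g = g := by
  classical
  funext A
  have h1 := sum_heatBathUpdate G ξ hp hp1 hq U A
  calc ∑ B, heatBathUpdate G ξ p q U A B * g B
      = ∑ B, heatBathUpdate G ξ p q U A B * g A := by
        refine Finset.sum_congr rfl fun B _ => ?_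
        by_cases h : B \ U = A \ U
        · rw [hg B A h]
        · rw [heatBathUpdate_eq_zero G ξ U h, zero_mul, zero_mul]
    _ = g A := by
        rw [← Finset.sum_mul]
        convert one_mul (g A)
        convert h1

theorem heatBathUpdate_mulVec_invariant [Fintype (Config G)] (U : Set G.edgeSet)
    (f : Config G → ℝ) (A B : Config G) (h : A \ U = B \ U) :
    (heatBathUpdate G ξ p q U).mulVec f A = (heatBathUpdate G ξ p q U).mulVec f B := by
  simp only [Matrix.mulVec, dotProduct, heatBathUpdate_congr G ξ U h]

/-- With the two preceding facts this makes the update the orthogonal projection, in `L²` of the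
measure, onto the functions that ignore `U`. -/
theorem heatBathUpdate_selfAdjoint [Fintype (Config G)] (U : Set G.edgeSet)
    (f g : Config G → ℝ) :
    ∑ A, measure G ξ p q A * (f A * (heatBathUpdate G ξ p q U).mulVec g A) =
      ∑ A, measure G ξ p q A * ((heatBathUpdate G ξ p q U).mulVec f A * g A) := by
  simp only [Matrix.mulVec, dotProduct, Finset.mul_sum, Finset.sum_mul]
  rw [Finset.sum_comm]
  refine Finset.sum_congr rfl fun A _ => Finset.sum_congr rfl fun B _ => ?_
  linear_combination (f B * g A) * heatBathUpdate_reversible G ξ (p := p) (q := q) U B A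

variable [Fintype (Config G)]

/-- The Dirichlet form of a heat-bath update, as the expectation of a conditional variance. -/
theorem heatBathUpdate_dirichlet (hp : 0 < p) (hp1 : p < 1) (hq : 0 < q) (U : Set G.edgeSet)
    (f : Config G → ℝ) :
    ∑ A, measure G ξ p q A * (f A * (f A - (heatBathUpdate G ξ p q U).mulVec f A)) =
      ∑ A, measure G ξ p q A * (f A - (heatBathUpdate G ξ p q U).mulVec f A) ^ 2 := by
  set K := heatBathUpdate G ξ p q U with hK
  have h1 : K.mulVec (K.mulVec f) = K.mulVec f :=
    heatBathUpdate_mulVec_of_invariant G ξ hp hp1 hq U _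
      (heatBathUpdate_mulVec_invariant G ξ U f)
  have h2 := heatBathUpdate_selfAdjoint G ξ (p := p) (q := q) U f (K.mulVec f)
  rw [← hK, h1] at h2
  rw [← sub_eq_zero, ← Finset.sum_sub_distrib]
  rw [← sub_eq_zero, ← Finset.sum_sub_distrib] at h2
  rw [← h2]
  exact Finset.sum_congr rfl fun A _ => by ring

theorem heatBathUpdate_psd (hp : 0 < p) (hp1 : p < 1) (hq : 0 < q) (U : Set G.edgeSet)
    (f : Config G → ℝ) :
    0 ≤ ∑ A, measure G ξ p q A * (f A * (heatBathUpdate G ξ p q U).mulVec f A) := by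
  set K := heatBathUpdate G ξ p q U with hK
  have h1 : K.mulVec (K.mulVec f) = K.mulVec f :=
    heatBathUpdate_mulVec_of_invariant G ξ hp hp1 hq U _
      (heatBathUpdate_mulVec_invariant G ξ U f)
  have h2 := heatBathUpdate_selfAdjoint G ξ (p := p) (q := q) U f (K.mulVec f)
  rw [← hK, h1] at h2
  rw [h2]
  exact Finset.sum_nonneg fun A _ =>
    mul_nonneg (measure_pos G ξ hp hp1 hq A).le (mul_self_nonneg _)

/-- The conditional expectation is the best approximation by a function off `U`. -/
theorem heatBathUpdate_dirichlet_le (hp : 0 < p) (hp1 : p < 1) (hq : 0 < q) (U : Set G.edgeSet)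
    (f g : Config G → ℝ) (hg : ∀ A B : Config G, A \ U = B \ U → g A = g B) :
    ∑ A, measure G ξ p q A * (f A * (f A - (heatBathUpdate G ξ p q U).mulVec f A)) ≤
      ∑ A, measure G ξ p q A * (f A - g A) ^ 2 := by
  set K := heatBathUpdate G ξ p q U with hK
  have hKg : K.mulVec g = g := heatBathUpdate_mulVec_of_invariant G ξ hp hp1 hq U g hg
  have h2 := heatBathUpdate_selfAdjoint G ξ (p := p) (q := q) U f g
  -- The projection maps `f - g` to `K f - g`, whose squared norm is exactly the excess of the right
  -- side over the left (`h4`).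
  have h3 := heatBathUpdate_psd G ξ hp hp1 hq U (f - g)
  rw [← hK, hKg] at h2
  rw [← hK, Matrix.mulVec_sub, hKg] at h3
  have h4 : ∑ A, measure G ξ p q A * (f A - g A) ^ 2 -
      ∑ A, measure G ξ p q A * (f A * (f A - K.mulVec f A)) =
      ∑ A, measure G ξ p q A * ((f - g) A * (K.mulVec f - g) A) -
      (∑ A, measure G ξ p q A * (f A * g A) -
        ∑ A, measure G ξ p q A * (K.mulVec f A * g A)) := by
    simp only [← Finset.sum_sub_distrib, Pi.sub_apply]
    exact Finset.sum_congr rfl fun A _ => by ring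
  rw [h2, sub_self, sub_zero] at h4
  linarith

end HeatBath

section Dynamics

variable {V : Type*} [Fintype V] (G : SimpleGraph V) (ξ : Setoid V) {p q : ℝ}

theorem edgeDynamics_reversible (A B : Config G) :
    measure G ξ p q A * edgeDynamics G ξ p q A B =
      measure G ξ p q B * edgeDynamics G ξ p q B A := by
  simp only [edgeDynamics, mul_div_assoc', Finset.mul_sum]
  congr 1
  exact Finset.sum_congr rfl fun e _ => heatBathUpdate_reversible G ξ {e} A B

open scoped Classical in
theorem edgeDynamics_mulVec (f : Config G → ℝ) (A : Config G) :
    (edgeDynamics G ξ p q).mulVec f A =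
      (∑ e : G.edgeSet, (heatBathUpdate G ξ p q {e}).mulVec f A) / (Nat.card G.edgeSet : ℝ) := by
  simp only [edgeDynamics, Matrix.mulVec, dotProduct, Finset.sum_div, Finset.sum_mul]
  rw [Finset.sum_comm]
  refine Finset.sum_congr rfl fun e _ => Finset.sum_congr rfl fun B _ => ?_
  ring

open scoped Classical in
theorem edgeDynamics_mulVec_one [Nonempty G.edgeSet] (hp : 0 < p) (hp1 : p < 1) (hq : 0 < q) :
    (edgeDynamics G ξ p q).mulVec (fun _ => 1) = fun _ => 1 := by
  funext A
  rw [edgeDynamics_mulVec]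
  have : ∀ e : G.edgeSet, (heatBathUpdate G ξ p q {e}).mulVec (fun _ => 1) A = 1 := fun e =>
    congrFun (heatBathUpdate_mulVec_of_invariant G ξ hp hp1 hq {e} (fun _ => 1)
      fun _ _ _ => rfl) A
  simp only [this, Finset.sum_const, Finset.card_univ, nsmul_eq_mul, mul_one,
    Nat.card_eq_fintype_card]
  exact div_self (Nat.cast_ne_zero.2 Fintype.card_ne_zero)

open scoped Classical in
-- The chain is the average of the single-edge projections, so its Dirichlet form is the average of
-- theirs; an edge is needed for the weights `1 / |E|` to sum to `1`.
theorem edgeDynamics_dirichlet [Nonempty G.edgeSet] (f : Config G → ℝ) :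
    ∑ A, measure G ξ p q A * (f A * (f A - (edgeDynamics G ξ p q).mulVec f A)) =
      (∑ e : G.edgeSet, ∑ A, measure G ξ p q A *
        (f A * (f A - (heatBathUpdate G ξ p q {e}).mulVec f A))) / (Nat.card G.edgeSet : ℝ) := by
  have hN : (Nat.card G.edgeSet : ℝ) ≠ 0 := by
    rw [Nat.card_eq_fintype_card]
    exact Nat.cast_ne_zero.2 Fintype.card_ne_zero
  rw [Finset.sum_comm, Finset.sum_div]
  refine Finset.sum_congr rfl fun A _ => ?_
  rw [edgeDynamics_mulVec, ← Finset.mul_sum, ← Finset.mul_sum, Finset.sum_sub_distrib,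
    Finset.sum_const, Finset.card_univ, ← Nat.card_eq_fintype_card, nsmul_eq_mul]
  field_simp

open scoped Classical in
theorem edgeDynamics_psd (hp : 0 < p) (hp1 : p < 1) (hq : 0 < q) (f : Config G → ℝ) :
    0 ≤ ∑ A, measure G ξ p q A * (f A * (edgeDynamics G ξ p q).mulVec f A) := by
  have : ∑ A, measure G ξ p q A * (f A * (edgeDynamics G ξ p q).mulVec f A) =
      (∑ e : G.edgeSet, ∑ A, measure G ξ p q A *
        (f A * (heatBathUpdate G ξ p q {e}).mulVec f A)) / (Nat.card G.edgeSet : ℝ) := by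
    rw [Finset.sum_comm, Finset.sum_div]
    refine Finset.sum_congr rfl fun A _ => ?_
    rw [edgeDynamics_mulVec, ← Finset.mul_sum, ← Finset.mul_sum]
    ring
  rw [this]
  exact div_nonneg (Finset.sum_nonneg fun e _ => heatBathUpdate_psd G ξ hp hp1 hq {e} f)
    (Nat.cast_nonneg _)

end Dynamics

/-! ### Comparison of spectral gaps under a projection -/

section Comparison

variable {V W : Type*} [Fintype V] [Fintype W] (G : SimpleGraph V) (H : SimpleGraph W)
  (ξ : Setoid V) (ζ : Setoid W) {p p' q : ℝ}

open scoped Classical in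
set_option maxHeartbeats 1000000 in
/-- Comparison of the spectral gaps of the edge dynamics on `G` and on `H`, for a map between the
configurations that pushes the measure on `H` forward to a measure comparable with that on `G`,
such that an edge of `H` influences at most one edge of `G`. -/
theorem edgeGap_le_of_comparison (hp : 0 < p) (hp1 : p < 1) (hp' : 0 < p') (hp1' : p' < 1)
    (hq : 0 < q) [Nonempty G.edgeSet] [Nonempty H.edgeSet] (ω : Config H → Config G)
    (S : Finset H.edgeSet) (τ : H.edgeSet → G.edgeSet)
    (hcard : ∀ i, (S.filter fun e => τ e = i).card ≤ 2)
    (hS : ∀ e ∈ S, ∀ A B : Config H, A \ {e} = B \ {e} → ω A \ {τ e} = ω B \ {τ e})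
    (hSc : ∀ e ∉ S, ∀ A B : Config H, A \ {e} = B \ {e} → ω A = ω B)
    (hN : 2 * Nat.card G.edgeSet ≤ Nat.card H.edgeSet)
    (C M : ℝ) (hC : 0 < C)
    (hlow : ∀ η : Config G, C * weight G ξ p q η ≤
      ∑ A : Config H, if ω A = η then weight H ζ p' q A else 0)
    (hupp : ∀ η : Config G, (∑ A : Config H, if ω A = η then weight H ζ p' q A else 0) ≤
      C * M * weight G ξ p q η)
    (ε : ℝ) (hε : ε < 1) (hgap : edgeGap G ξ p q ≤ ε) :
    edgeGap H ζ p' q ≤ M * ε := by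
  obtain ⟨f, hf, hf0, hfε⟩ := exists_rayleigh_of_absoluteSpectralGap_le _
    (edgeDynamics_mulVec_one G ξ hp hp1 hq) _ (measure_pos G ξ hp hp1 hq)
    (edgeDynamics_reversible G ξ) (edgeDynamics_psd G ξ hp hp1 hq) ε hε hgap
  set π := measure G ξ p q with hπ
  set μ := measure H ζ p' q with hμ
  have hπ0 : ∀ η, 0 < π η := measure_pos G ξ hp hp1 hq
  have hμ0 : ∀ A, 0 < μ A := measure_pos H ζ hp' hp1' hq
  have hμ1 : ∑ A, μ A = 1 := sum_measure H ζ hp' hp1' hq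
  have hπ1 : ∑ A, π A = 1 := sum_measure G ξ hp hp1 hq
  set ZG := ∑ B : Config G, weight G ξ p q B with hZG
  set ZH := ∑ B : Config H, weight H ζ p' q B with hZH
  have hZG0 : 0 < ZG := sum_weight_pos G ξ hp hp1 hq
  have hZH0 : 0 < ZH := sum_weight_pos H ζ hp' hp1' hq
  -- With the partition functions absorbed, the push-forward of `μ` lies between `a * π` and `a * M
  -- * π`.
  set a := C * ZG / ZH with ha
  have ha0 : 0 < a := by positivity
  have hpush : ∀ g : Config G → ℝ, ∑ A, μ A * g (ω A) =
      ∑ η, (∑ A, if ω A = η then weight H ζ p' q A else 0) / ZH * g η := by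
    intro g
    simp only [Finset.sum_div, Finset.sum_mul]
    rw [Finset.sum_comm]
    refine Finset.sum_congr rfl fun A _ => ?_
    rw [Finset.sum_eq_single (ω A)]
    · rw [if_pos rfl]
      rfl
    · intro η _ hη
      rw [if_neg (Ne.symm hη), zero_div, zero_mul]
    · intro h
      exact absurd (Finset.mem_univ _) h
  have hπw : ∀ η, weight G ξ p q η = π η * ZG := fun η => by
    rw [hπ, measure, ← hZG, div_mul_cancel₀ _ hZG0.ne']
  have hge : ∀ g : Config G → ℝ, (∀ η, 0 ≤ g η) → a * ∑ η, π η * g η ≤ ∑ A, μ A * g (ω A) := by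
    intro g hg
    rw [hpush, Finset.mul_sum]
    refine Finset.sum_le_sum fun η _ => ?_
    rw [← mul_assoc]
    refine mul_le_mul_of_nonneg_right ?_ (hg η)
    rw [ha, div_mul_eq_mul_div]
    refine div_le_div_of_nonneg_right ?_ hZH0.le
    refine le_trans (le_of_eq ?_) (hlow η)
    rw [hπw]; ring
  have hle : ∀ g : Config G → ℝ, (∀ η, 0 ≤ g η) →
      ∑ A, μ A * g (ω A) ≤ a * M * ∑ η, π η * g η := by
    intro g hg
    rw [hpush, Finset.mul_sum]
    refine Finset.sum_le_sum fun η _ => ?_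
    rw [← mul_assoc]
    refine mul_le_mul_of_nonneg_right ?_ (hg η)
    have : a * M * π η = C * M * weight G ξ p q η / ZH := by
      rw [hπw, ha]; ring
    rw [this]
    exact div_le_div_of_nonneg_right (hupp η) hZH0.le
  have hM : 0 ≤ M := by
    have h1 := hle (fun _ => 1) fun _ => zero_le_one
    simp only [mul_one, hμ1, hπ1] at h1
    by_contra hM
    have := mul_neg_of_pos_of_neg ha0 (not_le.1 hM)
    linarith
  set D : G.edgeSet → ℝ := fun i => ∑ η, π η *
    (f η * (f η - (heatBathUpdate G ξ p q {i}).mulVec f η)) with hD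
  have hD0 : ∀ i, 0 ≤ D i := fun i => by
    simp only [hD, hπ]
    rw [heatBathUpdate_dirichlet G ξ hp hp1 hq {i} f]
    exact Finset.sum_nonneg fun A _ => mul_nonneg (hπ0 A).le (sq_nonneg _)
  have hvpos : 0 < ∑ η, π η * f η ^ 2 := by
    obtain ⟨x, hx⟩ := Function.ne_iff.1 hf
    exact Finset.sum_pos' (fun y _ => mul_nonneg (hπ0 y).le (sq_nonneg _))
      ⟨x, Finset.mem_univ x, mul_pos (hπ0 x) (sq_pos_iff.2 hx)⟩
  have hm : (0 : ℝ) < Nat.card G.edgeSet := by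
    rw [Nat.card_eq_fintype_card]
    exact Nat.cast_pos.2 Fintype.card_pos
  have hNH : (2 : ℝ) * Nat.card G.edgeSet ≤ Nat.card H.edgeSet := by exact_mod_cast hN
  rw [edgeDynamics_dirichlet] at hfε
  -- The mean of `f ∘ ω` under `μ` need not be `0`, since the push-forward is only comparable with
  -- `π`; hence the recentring.
  obtain ⟨b, hb⟩ : ∃ b, b = ∑ A, μ A * f (ω A) := ⟨_, rfl⟩
  set F : Config H → ℝ := fun A => f (ω A) - b with hF
  -- As `f` has mean zero under `π`, shifting it by `b` can only increase its second moment.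
  have hvar : a * ∑ η, π η * f η ^ 2 ≤ ∑ A, μ A * F A ^ 2 := by
    refine le_trans ?_ (hge (fun η => (f η - b) ^ 2) fun η => sq_nonneg _)
    refine mul_le_mul_of_nonneg_left ?_ ha0.le
    have : ∑ η, π η * (f η - b) ^ 2 =
        ∑ η, π η * f η ^ 2 - 2 * b * ∑ η, π η * f η + b ^ 2 * ∑ η, π η := by
      rw [Finset.mul_sum, Finset.mul_sum, ← Finset.sum_sub_distrib, ← Finset.sum_add_distrib]
      exact Finset.sum_congr rfl fun η _ => by ring
    rw [this, hf0, hπ1]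
    nlinarith [sq_nonneg b]
  have hF0 : ∑ A, μ A * F A = 0 := by
    simp only [hF, mul_sub, Finset.sum_sub_distrib, ← Finset.sum_mul, hμ1, one_mul]
    rw [← hb, sub_self]
  have hFne : F ≠ 0 := by
    intro h0
    have : ∑ A, μ A * F A ^ 2 = 0 := by
      simp [h0]
    rw [this] at hvar
    have := mul_pos ha0 hvpos
    linarith
  refine absoluteSpectralGap_le_of_rayleigh _ (edgeDynamics_mulVec_one H ζ hp' hp1' hq) μ hμ0 hμ1
    (edgeDynamics_reversible H ζ) _ F hFne hF0 ?_
  rw [edgeDynamics_dirichlet]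
  -- The conditional expectation of `f` given the edges other than `τ e`, pulled back by `ω`, does
  -- not depend on `e`. It therefore competes with the optimal approximation of `F`, at the cost of
  -- the conditional variance on `G`.
  have hedge : ∀ e ∈ S, ∑ A, μ A *
      (F A * (F A - (heatBathUpdate H ζ p' q {e}).mulVec F A)) ≤ a * M * D (τ e) := by
    intro e he
    refine (heatBathUpdate_dirichlet_le H ζ hp' hp1' hq {e} F
      (fun A => (heatBathUpdate G ξ p q {τ e}).mulVec f (ω A) - b) ?_).trans ?_
    · intro A B hAB
      rw [heatBathUpdate_mulVec_invariant G ξ {τ e} f _ _ (hS e he A B hAB)]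
    · simp only [hD, hπ]
      rw [heatBathUpdate_dirichlet G ξ hp hp1 hq {τ e} f]
      refine le_trans (le_of_eq ?_)
        (hle (fun η => (f η - (heatBathUpdate G ξ p q {τ e}).mulVec f η) ^ 2)
          fun η => sq_nonneg _)
      refine Finset.sum_congr rfl fun A _ => ?_
      simp only [hF]
      ring
  have hedge0 : ∀ e ∉ S, ∑ A, μ A *
      (F A * (F A - (heatBathUpdate H ζ p' q {e}).mulVec F A)) = 0 := by
    intro e he
    rw [heatBathUpdate_mulVec_of_invariant H ζ hp' hp1' hq {e} F fun A B hAB => by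
      simp only [hF, hSc e he A B hAB]]
    simp
  -- The factor `2`, from the edges of `H` over the same edge of `G`, is later cancelled by `2 |E_G|
  -- ≤ |E_H|` in the averaging over edges.
  have hsum : ∑ e : H.edgeSet, ∑ A, μ A *
      (F A * (F A - (heatBathUpdate H ζ p' q {e}).mulVec F A)) ≤ 2 * (a * M * ∑ i, D i) := by
    rw [← Finset.sum_subset (Finset.subset_univ S) fun e _ he => hedge0 e he]
    refine (Finset.sum_le_sum hedge).trans ?_
    rw [← Finset.sum_fiberwise S τ, Finset.mul_sum, Finset.mul_sum]
    refine Finset.sum_le_sum fun i _ => ?_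
    have h1 : ∑ e ∈ S with τ e = i, a * M * D (τ e) = ∑ e ∈ S with τ e = i, a * M * D i :=
      Finset.sum_congr rfl fun e he => by rw [(Finset.mem_filter.1 he).2]
    rw [h1, Finset.sum_const, nsmul_eq_mul]
    refine mul_le_mul_of_nonneg_right ?_ (mul_nonneg (mul_nonneg ha0.le hM) (hD0 i))
    exact_mod_cast hcard i
  rw [div_le_iff₀ hm] at hfε
  rw [div_le_iff₀ (by linarith)]
  have hε0 : 0 ≤ ε := by
    by_contra hε0
    have h1 : 0 ≤ ∑ i, D i := Finset.sum_nonneg fun i _ => hD0 i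
    have h2 := mul_neg_of_neg_of_pos (mul_neg_of_neg_of_pos (not_le.1 hε0) hvpos) hm
    exact absurd (h1.trans hfε) (not_le.2 h2)
  calc _ ≤ 2 * (a * M * ∑ i, D i) := hsum
    _ ≤ 2 * (a * M * (ε * ∑ η, π η * f η ^ 2 * Nat.card G.edgeSet)) := by
        have : 0 ≤ a * M := mul_nonneg ha0.le hM
        rw [← Finset.sum_mul, ← mul_assoc ε]
        gcongr
    _ = M * ε * (a * ∑ η, π η * f η ^ 2) * (2 * Nat.card G.edgeSet) := by
        rw [← Finset.sum_mul]; ring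
    _ ≤ M * ε * (∑ A, μ A * F A ^ 2) * Nat.card H.edgeSet := by
        have : 0 ≤ ∑ A, μ A * F A ^ 2 :=
          Finset.sum_nonneg fun A _ => mul_nonneg (hμ0 A).le (sq_nonneg _)
        gcongr

end Comparison

end RandomCluster

/-! ### Connected components after the addition of an edge -/

namespace SimpleGraph

variable {V : Type*} {H : SimpleGraph V} {u v : V}

theorem reachable_sup_edge (x y : V) (h : (H ⊔ edge u v).Reachable x y) :
    H.Reachable x y ∨ (H.Reachable x u ∧ H.Reachable v y) ∨
      (H.Reachable x v ∧ H.Reachable u y) := by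
  obtain ⟨w⟩ := h
  induction w with
  | nil => exact Or.inl (Reachable.refl _)
  | @cons x z y hxz _ ih =>
    rcases hxz with hxz | hxz
    · rcases ih with ih | ⟨h1, h2⟩ | ⟨h1, h2⟩
      · exact Or.inl (hxz.reachable.trans ih)
      · exact Or.inr (Or.inl ⟨hxz.reachable.trans h1, h2⟩)
      · exact Or.inr (Or.inr ⟨hxz.reachable.trans h1, h2⟩)
    · rw [edge_adj] at hxz
      rcases hxz.1 with ⟨rfl, rfl⟩ | ⟨rfl, rfl⟩
      · rcases ih with ih | ⟨h1, h2⟩ | ⟨h1, h2⟩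
        · exact Or.inr (Or.inl ⟨Reachable.refl _, ih⟩)
        · exact Or.inr (Or.inl ⟨Reachable.refl _, h2⟩)
        · exact Or.inl h2
      · rcases ih with ih | ⟨h1, h2⟩ | ⟨h1, h2⟩
        · exact Or.inr (Or.inr ⟨Reachable.refl _, ih⟩)
        · exact Or.inl h2
        · exact Or.inr (Or.inr ⟨Reachable.refl _, h2⟩)

theorem card_connectedComponent_sup_edge_of_reachable (h : H.Reachable u v) :
    Nat.card (H ⊔ edge u v).ConnectedComponent = Nat.card H.ConnectedComponent := by
  refine (Nat.card_eq_of_bijective (ConnectedComponent.map (Hom.ofLE (le_sup_left :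
    H ≤ H ⊔ edge u v))) ⟨?_, ConnectedComponent.surjective_map_ofLE le_sup_left⟩).symm
  refine ConnectedComponent.ind₂ fun x y hxy => ?_
  have hxy' : (H ⊔ edge u v).Reachable x y := ConnectedComponent.exact hxy
  refine ConnectedComponent.sound ?_
  rcases reachable_sup_edge x y hxy' with h1 | ⟨h1, h2⟩ | ⟨h1, h2⟩
  · exact h1
  · exact (h1.trans h).trans h2
  · exact (h1.trans h.symm).trans h2

theorem card_connectedComponent_sup_edge_of_not_reachable [Finite V] (h : ¬ H.Reachable u v) :
    Nat.card (H ⊔ edge u v).ConnectedComponent + 1 = Nat.card H.ConnectedComponent := by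
  classical
  have huv : u ≠ v := fun e => h (e ▸ Reachable.refl _)
  have hadj : (H ⊔ edge u v).Adj u v := Or.inr (by rw [edge_adj]; exact ⟨Or.inl ⟨rfl, rfl⟩, huv⟩)
  -- The component of `v` is absorbed into that of `u`; all the others survive unchanged.
  let F : {C : H.ConnectedComponent // C ≠ H.connectedComponentMk v} →
      (H ⊔ edge u v).ConnectedComponent :=
    fun C => C.1.map (Hom.ofLE le_sup_left)
  have hF : Function.Bijective F := by
    constructor
    · rintro ⟨C, hC⟩ ⟨D, hD⟩ hCD
      refine Subtype.ext ?_
      change C = D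
      induction C using ConnectedComponent.ind with | _ x
      induction D using ConnectedComponent.ind with | _ y
      have hxy : (H ⊔ edge u v).Reachable x y := ConnectedComponent.exact hCD
      rcases reachable_sup_edge x y hxy with h1 | ⟨h1, h2⟩ | ⟨h1, h2⟩
      · exact ConnectedComponent.sound h1
      · exact absurd (ConnectedComponent.sound h2.symm) hD
      · exact absurd (ConnectedComponent.sound h1) hC
    · intro C
      induction C using ConnectedComponent.ind with | _ x
      by_cases hx : H.Reachable x v
      · refine ⟨⟨H.connectedComponentMk u, fun e => h (ConnectedComponent.exact e)⟩, ?_⟩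
        refine ConnectedComponent.sound ?_
        exact hadj.reachable.trans (hx.symm.mono le_sup_left)
      · exact ⟨⟨H.connectedComponentMk x, fun e => hx (ConnectedComponent.exact e)⟩, rfl⟩
  rw [← Nat.card_eq_of_bijective F hF]
  have := Fintype.ofFinite H.ConnectedComponent
  have h1 : 0 < Nat.card H.ConnectedComponent :=
    Nat.card_pos_iff.2 ⟨⟨H.connectedComponentMk v⟩, inferInstance⟩
  rw [Nat.card_eq_fintype_card, Fintype.card_subtype_compl, Fintype.card_subtype_eq,
    ← Nat.card_eq_fintype_card]
  omega

/-- The certificate for all separations below: exhibit a set that no open edge or wiring leaves. -/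
theorem not_reachable_of_closed (S : Set V) (hS : ∀ x ∈ S, ∀ y, H.Adj x y → y ∈ S) (hu : u ∈ S)
    (hv : v ∉ S) : ¬ H.Reachable u v := by
  rintro ⟨w⟩
  induction w with
  | nil => exact hv hu
  | cons hxz _ ih => exact ih (hS _ hu _ hxz) hv

end SimpleGraph

namespace RandomCluster

variable {V : Type*} {G : SimpleGraph V} {ξ : Setoid V}

theorem openGraph_adj {A : Config G} {x y : V} :
    (openGraph G ξ A).Adj x y ↔ x ≠ y ∧ ((∃ e ∈ A, (e : Sym2 V) = s(x, y)) ∨ ξ x y) := by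
  simp only [openGraph, SimpleGraph.sup_adj, SimpleGraph.fromEdgeSet_adj, SimpleGraph.fromRel_adj,
    Set.mem_image]
  constructor
  · rintro (⟨h, h'⟩ | ⟨h, h' | h'⟩)
    · exact ⟨h', Or.inl h⟩
    · exact ⟨h, Or.inr h'⟩
    · exact ⟨h, Or.inr (ξ.symm h')⟩
  · rintro ⟨h, h' | h'⟩
    · exact Or.inl ⟨h', h⟩
    · exact Or.inr ⟨h, Or.inl h'⟩

theorem openGraph_mono {A B : Config G} (h : A ⊆ B) : openGraph G ξ A ≤ openGraph G ξ B :=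
  sup_le_sup_right (SimpleGraph.fromEdgeSet_mono (Set.image_mono h)) _

theorem openGraph_insert (A : Config G) (e : G.edgeSet) {u v : V} (he : (e : Sym2 V) = s(u, v)) :
    openGraph G ξ (insert e A) = openGraph G ξ A ⊔ SimpleGraph.edge u v := by
  unfold openGraph SimpleGraph.edge
  rw [Set.image_insert_eq, Set.insert_eq, SimpleGraph.fromEdgeSet_union, he]
  ac_rfl

variable [Finite V]

theorem numComponents_anti {A B : Config G} (h : A ⊆ B) :
    numComponents G ξ B ≤ numComponents G ξ A :=
  SimpleGraph.ConnectedComponent.card_le_card_of_le (openGraph_mono h)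

omit [Finite V] in
theorem numComponents_insert_of_reachable (A : Config G) (e : G.edgeSet) {u v : V}
    (he : (e : Sym2 V) = s(u, v)) (h : (openGraph G ξ A).Reachable u v) :
    numComponents G ξ (insert e A) = numComponents G ξ A := by
  unfold numComponents
  rw [openGraph_insert A e he, SimpleGraph.card_connectedComponent_sup_edge_of_reachable h]

theorem numComponents_insert_of_not_reachable (A : Config G) (e : G.edgeSet) {u v : V}
    (he : (e : Sym2 V) = s(u, v)) (h : ¬ (openGraph G ξ A).Reachable u v) :
    numComponents G ξ (insert e A) + 1 = numComponents G ξ A := by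
  unfold numComponents
  rw [openGraph_insert A e he, SimpleGraph.card_connectedComponent_sup_edge_of_not_reachable h]

theorem numComponents_le_insert (A : Config G) (e : G.edgeSet) :
    numComponents G ξ A ≤ numComponents G ξ (insert e A) + 1 := by
  obtain ⟨e, he⟩ := e
  induction e using Sym2.ind with | _ u v
  by_cases h : (openGraph G ξ A).Reachable u v
  · rw [numComponents_insert_of_reachable A ⟨s(u, v), he⟩ rfl h]
    omega
  · rw [numComponents_insert_of_not_reachable A ⟨s(u, v), he⟩ rfl h]

theorem numComponents_le_union (A B : Config G) :
    numComponents G ξ A ≤ numComponents G ξ (A ∪ B) + B.ncard := by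
  induction B, (Set.toFinite B) using Set.Finite.induction_on with
  | empty => simp
  | @insert e B he hB ih =>
    rw [Set.ncard_insert_of_notMem he hB, Set.union_insert]
    have := numComponents_le_insert (ξ := ξ) (A ∪ B) e
    omega

end RandomCluster

/-! ### Edges of the binary tree, indexed by their lower ends -/

section BinaryTree

variable {h : ℕ}

theorem binaryTree_edge_ends (e : (binaryTree h).edgeSet) :
    ∃ v u : TreeVertex h, 2 ≤ (v : ℕ) ∧ (u : ℕ) = (v : ℕ) / 2 ∧ (e : Sym2 (TreeVertex h)) = s(u, v) := by
  obtain ⟨e, he⟩ := e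
  induction e using Sym2.ind with | _ x y
  have hx := Finset.mem_Ico.1 x.2
  have hy := Finset.mem_Ico.1 y.2
  have hadj : (binaryTree h).Adj x y := he
  obtain ⟨-, h1 | h1⟩ := (SimpleGraph.fromRel_adj _ x y).1 hadj
  · exact ⟨y, x, by omega, h1.symm, rfl⟩
  · exact ⟨x, y, by omega, h1.symm, Sym2.eq_swap⟩

/-- The lower end of an edge of the binary tree. -/
noncomputable def treeChild (e : (binaryTree h).edgeSet) : TreeVertex h :=
  (binaryTree_edge_ends e).choose

/-- The upper end of an edge of the binary tree. -/
noncomputable def treeParent (e : (binaryTree h).edgeSet) : TreeVertex h :=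
  (binaryTree_edge_ends e).choose_spec.choose

theorem two_le_treeChild (e : (binaryTree h).edgeSet) : 2 ≤ (treeChild e : ℕ) :=
  (binaryTree_edge_ends e).choose_spec.choose_spec.1

theorem treeParent_val (e : (binaryTree h).edgeSet) :
    (treeParent e : ℕ) = (treeChild e : ℕ) / 2 :=
  (binaryTree_edge_ends e).choose_spec.choose_spec.2.1

theorem treeEdge_eq (e : (binaryTree h).edgeSet) :
    (e : Sym2 (TreeVertex h)) = s(treeParent e, treeChild e) :=
  (binaryTree_edge_ends e).choose_spec.choose_spec.2.2

theorem treeChild_injective : Function.Injective (treeChild (h := h)) := by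
  intro e f hef
  apply Subtype.ext
  have : treeParent e = treeParent f := Subtype.ext (by rw [treeParent_val, treeParent_val, hef])
  rw [treeEdge_eq, treeEdge_eq, this, hef]

theorem exists_treeEdge (v : ℕ) (hv : 2 ≤ v) (hv' : v < 2 ^ (h + 1)) :
    ∃ e : (binaryTree h).edgeSet, (treeChild e : ℕ) = v := by
  let x : TreeVertex h := ⟨v, Finset.mem_Ico.2 ⟨by omega, hv'⟩⟩
  let y : TreeVertex h := ⟨v / 2, Finset.mem_Ico.2 ⟨by omega, by omega⟩⟩
  have hadj : (binaryTree h).Adj y x := by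
    refine (SimpleGraph.fromRel_adj _ y x).2 ⟨?_, Or.inl rfl⟩
    intro hyx
    have : v / 2 = v := congrArg Subtype.val hyx
    omega
  refine ⟨⟨s(y, x), hadj⟩, ?_⟩
  set e : (binaryTree h).edgeSet := ⟨s(y, x), hadj⟩
  have h1 : s(y, x) = s(treeParent e, treeChild e) := treeEdge_eq e
  have h2 := two_le_treeChild e
  have h3 := treeParent_val e
  rw [Sym2.eq_iff] at h1
  rcases h1 with ⟨-, h1⟩ | ⟨h4, h5⟩
  · exact (congrArg Subtype.val h1).symm
  · have h6 : v / 2 = (treeChild e : ℕ) := congrArg Subtype.val h4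
    have h7 : v = (treeParent e : ℕ) := congrArg Subtype.val h5
    omega

end BinaryTree

/-! ### Leaf edges: the subdivision of `G` inside the tree -/

namespace TreeEmbedding

variable {V : Type*} {G : SimpleGraph V} {h ℓ : ℕ}

/-- The number of the leftmost leaf of the block of an edge. -/
def base (φ : TreeEmbedding G h ℓ) (i : G.edgeSet) : ℕ := 2 ^ h + φ.block i * 2 ^ ℓ

variable (φ : TreeEmbedding G h ℓ)

theorem base_lt (hℓ : 0 < ℓ) (hℓh : ℓ ≤ h) (i : G.edgeSet) : φ.base i + 1 < 2 ^ (h + 1) := by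
  have h1 : (φ.block i : ℕ) + 1 ≤ 2 ^ (h - ℓ) := (φ.block i).2
  have h2 : 2 ^ h = 2 ^ (h - ℓ) * 2 ^ ℓ := by rw [← pow_add, Nat.sub_add_cancel hℓh]
  have h3 : ((φ.block i : ℕ) + 1) * 2 ^ ℓ ≤ 2 ^ h := h2 ▸ Nat.mul_le_mul_right _ h1
  have h4 : 2 ^ 1 ≤ 2 ^ ℓ := Nat.pow_le_pow_right (by norm_num) hℓ
  rw [base, pow_succ]
  rw [add_mul] at h3
  omega

theorem base_div (hℓh : ℓ ≤ h) (i : G.edgeSet) : φ.base i / 2 ^ ℓ = 2 ^ (h - ℓ) + φ.block i := by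
  have h2 : 2 ^ h = 2 ^ (h - ℓ) * 2 ^ ℓ := by rw [← pow_add, Nat.sub_add_cancel hℓh]
  rw [base, h2, ← add_mul, Nat.mul_div_cancel _ (by positivity)]

theorem base_injective (i j : G.edgeSet) (hij : φ.base i = φ.base j) : i = j := by
  refine φ.block.injective (Fin.ext ?_)
  unfold base at hij
  exact Nat.eq_of_mul_eq_mul_right (pow_pos (by norm_num) ℓ) (Nat.add_left_cancel hij)

theorem two_dvd_base (hℓ : 0 < ℓ) (hℓh : ℓ ≤ h) (i : G.edgeSet) : 2 ∣ φ.base i :=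
  dvd_add (dvd_pow_self 2 (by omega)) (Dvd.dvd.mul_left (dvd_pow_self 2 hℓ.ne') _)

theorem pow_le_base (i : G.edgeSet) : 2 ^ h ≤ φ.base i := Nat.le_add_right _ _

theorem base_add_div (hℓ : 0 < ℓ) (hℓh : ℓ ≤ h) (i : G.edgeSet) (b : Bool) :
    (φ.base i + b.toNat) / 2 = φ.base i / 2 := by
  have := φ.two_dvd_base hℓ hℓh i
  have := Bool.toNat_lt b
  omega

/-- The ends of an edge of `G`. -/
def vert (k : G.edgeSet × Bool) : V := bif k.2 then φ.right k.1 else φ.left k.1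

theorem vert_ends (i : G.edgeSet) (b : Bool) :
    (i : Sym2 V) = s(φ.vert (i, b), φ.vert (i, !b)) := by
  cases b
  · exact (φ.ends i).symm
  · rw [Sym2.eq_swap]
    exact (φ.ends i).symm

variable (hℓ : 0 < ℓ) (hℓh : ℓ ≤ h)

include hℓ hℓh in
theorem exists_leaf (k : G.edgeSet × Bool) :
    ∃ x : TreeVertex h, (x : ℕ) = φ.base k.1 + k.2.toNat := by
  have h1 := φ.base_lt hℓ hℓh k.1
  have h2 := Bool.toNat_lt k.2
  have h3 := φ.pow_le_base k.1
  have h4 : 0 < 2 ^ h := by positivity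
  exact ⟨⟨φ.base k.1 + k.2.toNat, Finset.mem_Ico.2 ⟨by omega, by omega⟩⟩, rfl⟩

/-- The leaves that carry the ends of an edge of `G`. -/
noncomputable def leaf (k : G.edgeSet × Bool) : TreeVertex h := (φ.exists_leaf hℓ hℓh k).choose

theorem leaf_val (k : G.edgeSet × Bool) :
    (φ.leaf hℓ hℓh k : ℕ) = φ.base k.1 + k.2.toNat := (φ.exists_leaf hℓ hℓh k).choose_spec

theorem leaf_injective : Function.Injective (φ.leaf hℓ hℓh) := by
  rintro ⟨i, b⟩ ⟨j, b'⟩ hij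
  have h1 := congrArg Subtype.val hij
  rw [leaf_val, leaf_val] at h1
  have h2 := φ.two_dvd_base hℓ hℓh i
  have h3 := φ.two_dvd_base hℓ hℓh j
  have h4 := Bool.toNat_lt b
  have h5 := Bool.toNat_lt b'
  dsimp only at h1
  have h6 : i = j := φ.base_injective i j (by omega)
  have h7 : b.toNat = b'.toNat := by omega
  have h8 : b = b' := by cases b <;> cases b' <;> simp_all
  rw [h6, h8]

theorem carries_iff {x : TreeVertex h} {v : V} :
    φ.Carries x v ↔ ∃ k, x = φ.leaf hℓ hℓh k ∧ v = φ.vert k := by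
  constructor
  · rintro ⟨i, ⟨hx, hv⟩ | ⟨hx, hv⟩⟩
    · exact ⟨(i, false), Subtype.ext (by rw [leaf_val]; exact hx), hv⟩
    · exact ⟨(i, true), Subtype.ext (by rw [leaf_val]; exact hx), hv⟩
  · rintro ⟨⟨i, b⟩, rfl, rfl⟩
    refine ⟨i, ?_⟩
    rw [leaf_val]
    cases b
    · exact Or.inl ⟨rfl, rfl⟩
    · exact Or.inr ⟨rfl, rfl⟩

theorem exists_leafEdge (k : G.edgeSet × Bool) :
    ∃ e : (binaryTree h).edgeSet, treeChild e = φ.leaf hℓ hℓh k := by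
  have h1 : 2 ≤ (φ.leaf hℓ hℓh k : ℕ) := by
    rw [leaf_val]
    have h3 := φ.pow_le_base k.1
    have h4 : 2 ^ 1 ≤ 2 ^ h := Nat.pow_le_pow_right (by norm_num) (by omega)
    omega
  obtain ⟨e, he⟩ := exists_treeEdge _ h1 (Finset.mem_Ico.1 (φ.leaf hℓ hℓh k).2).2
  exact ⟨e, Subtype.ext he⟩

/-- The edges from the leaves that carry the ends of an edge of `G` to their parent. -/
noncomputable def leafEdge (k : G.edgeSet × Bool) : (binaryTree h).edgeSet :=
  (φ.exists_leafEdge hℓ hℓh k).choose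

theorem treeChild_leafEdge (k : G.edgeSet × Bool) :
    treeChild (φ.leafEdge hℓ hℓh k) = φ.leaf hℓ hℓh k := (φ.exists_leafEdge hℓ hℓh k).choose_spec

theorem leafEdge_injective : Function.Injective (φ.leafEdge hℓ hℓh) := by
  intro k k' hk
  apply φ.leaf_injective hℓ hℓh
  rw [← treeChild_leafEdge, ← treeChild_leafEdge, hk]

/-- The parent of the leaves that carry the ends of an edge of `G`. -/
noncomputable def mid (i : G.edgeSet) : TreeVertex h := treeParent (φ.leafEdge hℓ hℓh (i, false))

theorem mid_val (i : G.edgeSet) : (φ.mid hℓ hℓh i : ℕ) = φ.base i / 2 := by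
  rw [mid, treeParent_val, treeChild_leafEdge, leaf_val]
  rfl

theorem treeParent_leafEdge (k : G.edgeSet × Bool) :
    treeParent (φ.leafEdge hℓ hℓh k) = φ.mid hℓ hℓh k.1 := by
  apply Subtype.ext
  rw [mid_val, treeParent_val, treeChild_leafEdge, leaf_val, φ.base_add_div hℓ hℓh]

theorem leafEdge_eq (k : G.edgeSet × Bool) :
    (φ.leafEdge hℓ hℓh k : Sym2 (TreeVertex h)) = s(φ.mid hℓ hℓh k.1, φ.leaf hℓ hℓh k) := by
  rw [treeEdge_eq, treeParent_leafEdge, treeChild_leafEdge]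

theorem mid_injective : Function.Injective (φ.mid hℓ hℓh) := by
  intro i j hij
  have h1 := congrArg Subtype.val hij
  rw [mid_val, mid_val] at h1
  have h2 := φ.two_dvd_base hℓ hℓh i
  have h3 := φ.two_dvd_base hℓ hℓh j
  exact φ.base_injective i j (by omega)

theorem mid_lt (i : G.edgeSet) : (φ.mid hℓ hℓh i : ℕ) < 2 ^ h := by
  rw [mid_val]
  have := φ.base_lt hℓ hℓh i
  rw [pow_succ] at this
  omega

theorem le_leaf (k : G.edgeSet × Bool) : 2 ^ h ≤ (φ.leaf hℓ hℓh k : ℕ) := by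
  rw [leaf_val]
  have := φ.pow_le_base k.1
  omega

theorem mid_ne_leaf (i : G.edgeSet) (k : G.edgeSet × Bool) :
    φ.mid hℓ hℓh i ≠ φ.leaf hℓ hℓh k := by
  intro h1
  have h2 := φ.mid_lt hℓ hℓh i
  rw [h1] at h2
  exact absurd h2 (not_lt.2 (φ.le_leaf hℓ hℓh k))

theorem boundary_leaf_iff {x y : TreeVertex h} (hxy : x ≠ y) :
    φ.boundary hℓ x y ↔ ∃ k k', x = φ.leaf hℓ hℓh k ∧ y = φ.leaf hℓ hℓh k' ∧
      φ.vert k = φ.vert k' := by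
  constructor
  · rintro (h1 | ⟨v, h1, h2⟩)
    · exact absurd h1 hxy
    · obtain ⟨k, hk, hv⟩ := (φ.carries_iff hℓ hℓh).1 h1
      obtain ⟨k', hk', hv'⟩ := (φ.carries_iff hℓ hℓh).1 h2
      exact ⟨k, k', hk, hk', hv.symm.trans hv'⟩
  · rintro ⟨k, k', hk, hk', hv⟩
    exact Or.inr ⟨φ.vert k, (φ.carries_iff hℓ hℓh).2 ⟨k, hk, rfl⟩,
      (φ.carries_iff hℓ hℓh).2 ⟨k', hk', hv⟩⟩

open RandomCluster in
/-- The edges of `G` whose two halves are open. -/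
def project (A : Config (binaryTree h)) : Config G := {i | ∀ b, φ.leafEdge hℓ hℓh (i, b) ∈ A}

section Leaves

open RandomCluster

variable (X : Set (G.edgeSet × Bool))

theorem openGraph_leafEdges_adj {x y : TreeVertex h} :
    (openGraph (binaryTree h) (φ.boundary hℓ) (φ.leafEdge hℓ hℓh '' X)).Adj x y →
      (∃ k ∈ X, (x = φ.mid hℓ hℓh k.1 ∧ y = φ.leaf hℓ hℓh k) ∨
        (x = φ.leaf hℓ hℓh k ∧ y = φ.mid hℓ hℓh k.1)) ∨
      ∃ k k', x = φ.leaf hℓ hℓh k ∧ y = φ.leaf hℓ hℓh k' ∧ φ.vert k = φ.vert k' := by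
  intro hxy
  rw [openGraph_adj] at hxy
  obtain ⟨hne, ⟨_, ⟨k, hk, rfl⟩, he⟩ | hξ⟩ := hxy
  · rw [leafEdge_eq, Sym2.eq_iff] at he
    rcases he with ⟨h1, h2⟩ | ⟨h1, h2⟩
    · exact Or.inl ⟨k, hk, Or.inl ⟨h1.symm, h2.symm⟩⟩
    · exact Or.inl ⟨k, hk, Or.inr ⟨h2.symm, h1.symm⟩⟩
  · exact Or.inr ((φ.boundary_leaf_iff hℓ hℓh hne).1 hξ)

theorem reachable_mid_leaf {k : G.edgeSet × Bool} (hk : k ∈ X) :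
    (openGraph (binaryTree h) (φ.boundary hℓ) (φ.leafEdge hℓ hℓh '' X)).Reachable
      (φ.mid hℓ hℓh k.1) (φ.leaf hℓ hℓh k) := by
  refine SimpleGraph.Adj.reachable (openGraph_adj.2 ⟨φ.mid_ne_leaf hℓ hℓh _ _, Or.inl ?_⟩)
  exact ⟨_, ⟨k, hk, rfl⟩, φ.leafEdge_eq hℓ hℓh k⟩

theorem reachable_leaf_of_vert_eq {k k' : G.edgeSet × Bool} (hk : φ.vert k = φ.vert k') :
    (openGraph (binaryTree h) (φ.boundary hℓ) (φ.leafEdge hℓ hℓh '' X)).Reachable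
      (φ.leaf hℓ hℓh k) (φ.leaf hℓ hℓh k') := by
  by_cases h1 : φ.leaf hℓ hℓh k = φ.leaf hℓ hℓh k'
  · rw [h1]
  · refine SimpleGraph.Adj.reachable (openGraph_adj.2 ⟨h1, Or.inr ?_⟩)
    exact (φ.boundary_leaf_iff hℓ hℓh h1).2 ⟨k, k', rfl, rfl, hk⟩

/-- Each open edge on a path in `G` lifts to its two open halves through the middle vertex;
consecutive lifts are joined by the wiring. -/
theorem reachable_leaf_of_reachable_vert {v w : V}
    (hvw : (openGraph G ⊥ {i | ∀ b, (i, b) ∈ X}).Reachable v w) (k k' : G.edgeSet × Bool)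
    (hk : φ.vert k = v) (hk' : φ.vert k' = w) :
    (openGraph (binaryTree h) (φ.boundary hℓ) (φ.leafEdge hℓ hℓh '' X)).Reachable
      (φ.leaf hℓ hℓh k) (φ.leaf hℓ hℓh k') := by
  obtain ⟨p⟩ := hvw
  induction p generalizing k with
  | nil => exact φ.reachable_leaf_of_vert_eq hℓ hℓh X (hk.trans hk'.symm)
  | @cons v u w hvu _ ih =>
    rw [openGraph_adj] at hvu
    obtain ⟨hne, ⟨i, hi, hiv⟩ | h0⟩ := hvu
    · obtain ⟨b, hb, hb'⟩ : ∃ b, φ.vert (i, b) = v ∧ φ.vert (i, !b) = u := by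
        rw [φ.vert_ends i false, Sym2.eq_iff] at hiv
        rcases hiv with ⟨h1, h2⟩ | ⟨h1, h2⟩
        · exact ⟨false, h1, h2⟩
        · exact ⟨true, h2, h1⟩
      refine (φ.reachable_leaf_of_vert_eq hℓ hℓh X (hk.trans hb.symm)).trans ?_
      refine (φ.reachable_mid_leaf hℓ hℓh X (hi b)).symm.trans ?_
      exact (φ.reachable_mid_leaf hℓ hℓh X (hi !b)).trans (ih (i, !b) hb' hk')
    · exact absurd h0 hne

theorem reachable_vert_of_reachable_leaf (k k' : G.edgeSet × Bool)
    (hk : (openGraph (binaryTree h) (φ.boundary hℓ) (φ.leafEdge hℓ hℓh '' X)).Reachable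
      (φ.leaf hℓ hℓh k) (φ.leaf hℓ hℓh k')) :
    (openGraph G ⊥ {i | ∀ b, (i, b) ∈ X}).Reachable (φ.vert k) (φ.vert k') := by
  set H := openGraph G ⊥ {i | ∀ b, (i, b) ∈ X} with hH
  -- The separating set: all leaves that carry a vertex reachable from `φ.vert k`, and the middle
  -- vertices attached to such a leaf by an open half.
  let S : Set (TreeVertex h) := {x | ∃ j b, H.Reachable (φ.vert k) (φ.vert (j, b)) ∧
    (x = φ.leaf hℓ hℓh (j, b) ∨ (x = φ.mid hℓ hℓh j ∧ (j, b) ∈ X))}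
  have hleaf : ∀ m, φ.leaf hℓ hℓh m ∈ S → H.Reachable (φ.vert k) (φ.vert m) := by
    rintro m ⟨j, b, hr, h1 | ⟨h1, -⟩⟩
    · rwa [φ.leaf_injective hℓ hℓh h1]
    · exact absurd h1.symm (φ.mid_ne_leaf hℓ hℓh _ _)
  have hstep : ∀ i b, (i, b) ∈ X → (i, !b) ∈ X → H.Reachable (φ.vert (i, b)) (φ.vert (i, !b)) := by
    intro i b h1 h2
    by_cases hne : φ.vert (i, b) = φ.vert (i, !b)
    · rw [hne]
    · refine SimpleGraph.Adj.reachable (openGraph_adj.2 ⟨hne, Or.inl ⟨i, ?_, φ.vert_ends i b⟩⟩)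
      intro b'
      cases b <;> cases b' <;> assumption
  by_contra hcon
  refine SimpleGraph.not_reachable_of_closed S ?_ ?_ (fun h1 => hcon (hleaf k' h1)) hk
  · intro x hx y hxy
    rcases φ.openGraph_leafEdges_adj hℓ hℓh X hxy with ⟨m, hm, ⟨rfl, rfl⟩ | ⟨rfl, rfl⟩⟩ |
      ⟨m, m', rfl, rfl, hmm⟩
    · obtain ⟨j, b, hr, h1 | ⟨h1, h2⟩⟩ := hx
      · exact absurd h1 (φ.mid_ne_leaf hℓ hℓh _ _)
      · obtain ⟨i, b'⟩ := m
        obtain rfl : i = j := φ.mid_injective hℓ hℓh h1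
        refine ⟨i, b', ?_, Or.inl rfl⟩
        by_cases hb : b' = b
        · rwa [hb]
        · obtain rfl : b' = !b := by cases b <;> cases b' <;> simp_all
          exact hr.trans (hstep i b h2 hm)
    · exact ⟨m.1, m.2, hleaf m hx, Or.inr ⟨rfl, hm⟩⟩
    · refine ⟨m'.1, m'.2, ?_, Or.inl rfl⟩
      have := hleaf m hx
      rwa [hmm] at this
  · exact ⟨k.1, k.2, SimpleGraph.Reachable.refl _, Or.inl rfl⟩

/-- The numbers of components on the tree and on `G`, for configurations on the leaf edges. -/
theorem numComponents_leafEdges [Finite V] :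
    numComponents (binaryTree h) (φ.boundary hℓ) (φ.leafEdge hℓ hℓh '' X) +
        {i : G.edgeSet | ∃ b, (i, b) ∈ X}.ncard + numComponents G ⊥ ∅ =
      numComponents (binaryTree h) (φ.boundary hℓ) ∅ +
        numComponents G ⊥ {i | ∀ b, (i, b) ∈ X} := by
  induction X, (Set.toFinite X) using Set.Finite.induction_on with
  | empty => simp
  | @insert k X hk hX ih =>
    obtain ⟨i, b⟩ := k
    rw [Set.image_insert_eq]
    -- Opening the second half of `i` completes the edge: the middle vertex is already tied to the
    -- other leaf, so components merge on the tree exactly when they merge on `G`.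
    by_cases hb : (i, !b) ∈ X
    · have h1 : {j : G.edgeSet | ∃ b', (j, b') ∈ insert (i, b) X} =
          {j : G.edgeSet | ∃ b', (j, b') ∈ X} := by
        ext j
        simp only [Set.mem_ofPred_eq, Set.mem_insert_iff, Prod.mk.injEq]
        constructor
        · rintro ⟨b', ⟨rfl, rfl⟩ | h2⟩
          · exact ⟨_, hb⟩
          · exact ⟨b', h2⟩
        · rintro ⟨b', h2⟩
          exact ⟨b', Or.inr h2⟩
      have h2 : {j : G.edgeSet | ∀ b', (j, b') ∈ insert (i, b) X} =
          insert i {j : G.edgeSet | ∀ b', (j, b') ∈ X} := by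
        ext j
        simp only [Set.mem_ofPred_eq, Set.mem_insert_iff, Prod.mk.injEq]
        constructor
        · intro h3
          by_cases hj : j = i
          · exact Or.inl hj
          · exact Or.inr fun b' => (h3 b').resolve_left fun h4 => hj h4.1
        · rintro (rfl | h3) b'
          · by_cases hb' : b' = b
            · exact Or.inl ⟨rfl, hb'⟩
            · obtain rfl : b' = !b := by cases b <;> cases b' <;> simp_all
              exact Or.inr hb
          · exact Or.inr (h3 b')
      rw [h1, h2]
      by_cases hr : (openGraph G ⊥ {j : G.edgeSet | ∀ b', (j, b') ∈ X}).Reachable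
          (φ.vert (i, b)) (φ.vert (i, !b))
      · rw [numComponents_insert_of_reachable _ i (φ.vert_ends i b) hr,
          numComponents_insert_of_reachable _ _ (φ.leafEdge_eq hℓ hℓh (i, b)) ?_]
        · exact ih
        · exact (φ.reachable_mid_leaf hℓ hℓh X hb).trans
            (φ.reachable_leaf_of_reachable_vert hℓ hℓh X hr.symm _ _ rfl rfl)
      · have h3 := numComponents_insert_of_not_reachable _ i (φ.vert_ends i b) hr
        have h4 := numComponents_insert_of_not_reachable (ξ := φ.boundary hℓ)
          (φ.leafEdge hℓ hℓh '' X) _ (φ.leafEdge_eq hℓ hℓh (i, b)) fun h4 => hr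
          (φ.reachable_vert_of_reachable_leaf hℓ hℓh X _ _
            (h4.symm.trans (φ.reachable_mid_leaf hℓ hℓh X hb)))
        omega
    -- Opening the first half ties the isolated middle vertex to a leaf: the tree loses a component,
    -- the count of touched blocks compensates, and `G` does not change.
    · have hi : ∀ b', (i, b') ∉ X := fun b' => by
        by_cases hb' : b' = b
        · rwa [hb']
        · obtain rfl : b' = !b := by cases b <;> cases b' <;> simp_all
          exact hb
      have h1 : {j : G.edgeSet | ∃ b', (j, b') ∈ insert (i, b) X} =
          insert i {j : G.edgeSet | ∃ b', (j, b') ∈ X} := by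
        ext j
        simp only [Set.mem_ofPred_eq, Set.mem_insert_iff, Prod.mk.injEq]
        constructor
        · rintro ⟨b', ⟨rfl, rfl⟩ | h2⟩
          · exact Or.inl rfl
          · exact Or.inr ⟨b', h2⟩
        · rintro (rfl | ⟨b', h2⟩)
          · exact ⟨b, Or.inl ⟨rfl, rfl⟩⟩
          · exact ⟨b', Or.inr h2⟩
      have h2 : {j : G.edgeSet | ∀ b', (j, b') ∈ insert (i, b) X} =
          {j : G.edgeSet | ∀ b', (j, b') ∈ X} := by
        ext j
        simp only [Set.mem_ofPred_eq, Set.mem_insert_iff, Prod.mk.injEq]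
        constructor
        · intro h3 b'
          have hj : j ≠ i := by
            rintro rfl
            rcases h3 (!b) with ⟨-, h4⟩ | h4
            · cases b <;> simp at h4
            · exact hb h4
          exact (h3 b').resolve_left fun h4 => hj h4.1
        · exact fun h3 b' => Or.inr (h3 b')
      rw [h1, h2, Set.ncard_insert_of_notMem (by rintro ⟨b', h3⟩; exact hi b' h3) (Set.toFinite _)]
      have h4 := numComponents_insert_of_not_reachable (ξ := φ.boundary hℓ)
          (φ.leafEdge hℓ hℓh '' X) _ (φ.leafEdge_eq hℓ hℓh (i, b)) (by
        refine SimpleGraph.not_reachable_of_closed {φ.mid hℓ hℓh i} ?_ rfl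
          (fun h3 => φ.mid_ne_leaf hℓ hℓh _ _ (Set.mem_singleton_iff.1 h3).symm)
        rintro _ rfl y hy
        rcases φ.openGraph_leafEdges_adj hℓ hℓh X hy with ⟨m, hm, ⟨h3, rfl⟩ | ⟨h3, rfl⟩⟩ |
          ⟨m, m', h3, rfl, hmm⟩
        · obtain ⟨j, b'⟩ := m
          obtain rfl : i = j := φ.mid_injective hℓ hℓh h3
          exact absurd hm (hi b')
        · exact absurd h3 (φ.mid_ne_leaf hℓ hℓh _ _)
        · exact absurd h3 (φ.mid_ne_leaf hℓ hℓh _ _))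
      omega

end Leaves

end TreeEmbedding

/-! ### Stems, and the components merged by the remaining tree edges -/

namespace TreeEmbedding

open RandomCluster

variable {V : Type*} {G : SimpleGraph V} {h ℓ : ℕ} (φ : TreeEmbedding G h ℓ) (hℓ : 0 < ℓ)
  (hℓh : ℓ ≤ h)

include hℓh in
theorem exists_stemEdge (i : G.edgeSet) (j : Fin (ℓ - 1)) :
    ∃ e : (binaryTree h).edgeSet, (treeChild e : ℕ) = φ.base i / 2 ^ ((j : ℕ) + 1) := by
  have hj := j.2
  refine exists_treeEdge _ ?_ ?_
  · rw [Nat.le_div_iff_mul_le (by positivity), ← pow_succ']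
    exact (Nat.pow_le_pow_right (by norm_num) (by omega)).trans (φ.pow_le_base i)
  · have := φ.base_lt (by omega) hℓh i
    exact (Nat.div_le_self _ _).trans_lt (by omega)

/-- The edges of the path from the parent of the leaves that carry the ends of an edge of `G` to
the root of the block of that edge. -/
noncomputable def stemEdge (k : G.edgeSet × Fin (ℓ - 1)) : (binaryTree h).edgeSet :=
  (φ.exists_stemEdge hℓh k.1 k.2).choose

theorem treeChild_stemEdge (k : G.edgeSet × Fin (ℓ - 1)) :
    (treeChild (φ.stemEdge hℓh k) : ℕ) = φ.base k.1 / 2 ^ ((k.2 : ℕ) + 1) :=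
  (φ.exists_stemEdge hℓh k.1 k.2).choose_spec

omit φ in
-- Halving `k` times lowers the binary logarithm from `h` to `h - k`. Since `j < h`, the value is
-- positive and the truncated subtraction loses nothing.
theorem level_unique {x y k j : ℕ} (hx : 2 ^ h ≤ x) (hx' : x < 2 ^ (h + 1)) (hy : 2 ^ h ≤ y)
    (hy' : y < 2 ^ (h + 1)) (hj : j < h) (hxy : x / 2 ^ k = y / 2 ^ j) : k = j := by
  have h0 : 0 < 2 ^ h := by positivity
  have h1 : Nat.log 2 x = h := (Nat.log_eq_iff (Or.inr ⟨by norm_num, by omega⟩)).2 ⟨hx, hx'⟩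
  have h2 : Nat.log 2 y = h := (Nat.log_eq_iff (Or.inr ⟨by norm_num, by omega⟩)).2 ⟨hy, hy'⟩
  have h3 := congrArg (Nat.log 2) hxy
  rw [Nat.log_div_base_pow, Nat.log_div_base_pow, h1, h2] at h3
  omega

include hℓ hℓh in
/-- Ancestors within a block determine the block. -/
theorem block_unique (i : G.edgeSet) (k' : G.edgeSet × Bool) {k j : ℕ} (hj : j < ℓ)
    (hxy : (φ.base k'.1 + k'.2.toNat) / 2 ^ k = φ.base i / 2 ^ j) : k'.1 = i ∧ k = j := by
  have h1 := φ.base_lt hℓ hℓh k'.1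
  have h2 := φ.base_lt hℓ hℓh i
  have h3 := φ.pow_le_base k'.1
  have h4 := φ.pow_le_base i
  have h5 := Bool.toNat_lt k'.2
  have hkj : k = j := level_unique (h := h) (by omega) (by omega) h4 (by omega) (by omega) hxy
  refine ⟨?_, hkj⟩
  subst hkj
  -- A common ancestor below the block root has the block root above it, and the root determines the
  -- block.
  have h6 : (φ.base k'.1 + k'.2.toNat) / 2 ^ ℓ = φ.base i / 2 ^ ℓ := by
    obtain ⟨m, rfl⟩ : ∃ m, ℓ = k + m := ⟨ℓ - k, by omega⟩
    rw [pow_add, ← Nat.div_div_eq_div_mul, ← Nat.div_div_eq_div_mul, hxy]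
  have h7 : (φ.base k'.1 + k'.2.toNat) / 2 ^ ℓ = φ.base k'.1 / 2 ^ ℓ := by
    obtain ⟨m, rfl⟩ : ∃ m, ℓ = 1 + m := ⟨ℓ - 1, by omega⟩
    rw [pow_add, ← Nat.div_div_eq_div_mul, ← Nat.div_div_eq_div_mul, pow_one,
      φ.base_add_div hℓ hℓh]
  rw [h7, φ.base_div hℓh, φ.base_div hℓh] at h6
  exact φ.block.injective (Fin.ext (by omega))

include hℓ in
theorem stemEdge_injective : Function.Injective (φ.stemEdge hℓh) := by
  rintro ⟨i, j⟩ ⟨i', j'⟩ hk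
  have h1 : (treeChild (φ.stemEdge hℓh (i, j)) : ℕ) = treeChild (φ.stemEdge hℓh (i', j')) := by
    rw [hk]
  rw [treeChild_stemEdge, treeChild_stemEdge] at h1
  have hj' := j'.2
  obtain ⟨h2, h3⟩ := φ.block_unique hℓ hℓh i' (i, false) (j := (j' : ℕ) + 1) (by omega) h1
  dsimp only at h2
  have h4 : (j : ℕ) + 1 = j' + 1 := h3
  rw [h2, Fin.ext (by omega : (j : ℕ) = j')]

theorem stemEdge_ne_leafEdge (k : G.edgeSet × Fin (ℓ - 1)) (k' : G.edgeSet × Bool) :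
    φ.stemEdge hℓh k ≠ φ.leafEdge hℓ hℓh k' := by
  intro hk
  have h1 : (treeChild (φ.stemEdge hℓh k) : ℕ) = treeChild (φ.leafEdge hℓ hℓh k') := by rw [hk]
  rw [treeChild_stemEdge, treeChild_leafEdge, leaf_val] at h1
  have hj := k.2.2
  have := φ.block_unique hℓ hℓh k.1 k' (j := (k.2 : ℕ) + 1) (k := 0) (by omega)
    (by rw [pow_zero, Nat.div_one, h1])
  omega

theorem openGraph_binaryTree_adj {A : Config (binaryTree h)} {ξ : Setoid (TreeVertex h)}
    {x y : TreeVertex h} (hxy : (openGraph (binaryTree h) ξ A).Adj x y) :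
    (∃ e ∈ A, (x = treeParent e ∧ y = treeChild e) ∨ (x = treeChild e ∧ y = treeParent e)) ∨
      (x ≠ y ∧ ξ x y) := by
  obtain ⟨hne, ⟨e, he, hxy⟩ | hξ⟩ := openGraph_adj.1 hxy
  · refine Or.inl ⟨e, he, ?_⟩
    rw [treeEdge_eq, Sym2.eq_iff] at hxy
    rcases hxy with ⟨h1, h2⟩ | ⟨h1, h2⟩
    · exact Or.inl ⟨h1.symm, h2.symm⟩
    · exact Or.inr ⟨h2.symm, h1.symm⟩
  · exact Or.inr ⟨hne, hξ⟩

/-- The lower end of `e` is isolated: an edge of `B` below it would have a larger child number, leaf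
edges in `L` hang from middle vertices only, and wired vertices are lower ends of leaf edges. -/
theorem not_reachable_of_maximal {L B : Config (binaryTree h)}
    (hL : L ⊆ Set.range (φ.leafEdge hℓ hℓh)) (e : (binaryTree h).edgeSet)
    (he : e ∉ Set.range (φ.leafEdge hℓ hℓh)) (heB : e ∉ B)
    (hmax : ∀ f ∈ B, (treeChild f : ℕ) ≤ treeChild e)
    (hmid : ∀ i, treeChild e ≠ φ.mid hℓ hℓh i) :
    ¬ (openGraph (binaryTree h) (φ.boundary hℓ) (L ∪ B)).Reachable
      (treeParent e) (treeChild e) := by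
  intro hr
  have h2 := two_le_treeChild e
  refine SimpleGraph.not_reachable_of_closed {treeChild e} ?_ rfl ?_ hr.symm
  · rintro _ rfl y hy
    exfalso
    rcases openGraph_binaryTree_adj hy with ⟨f, hf, ⟨h1, rfl⟩ | ⟨h1, rfl⟩⟩ | ⟨hne, hξ⟩
    · rcases hf with hf | hf
      · obtain ⟨k, rfl⟩ := hL hf
        rw [treeParent_leafEdge] at h1
        exact hmid _ h1
      · have h3 := hmax f hf
        have h4 := congrArg Subtype.val h1
        rw [treeParent_val] at h4
        omega
    · obtain rfl := treeChild_injective h1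
      rcases hf with hf | hf
      · exact he (hL hf)
      · exact heB hf
    · obtain ⟨k, k', h1, -⟩ := (φ.boundary_leaf_iff hℓ hℓh hne).1 hξ
      rw [← treeChild_leafEdge] at h1
      exact he ⟨k, (treeChild_injective h1).symm⟩
  · intro h1
    have h3 := congrArg Subtype.val (Set.mem_singleton_iff.1 h1)
    rw [treeParent_val] at h3
    omega

/-- Here the lower end of `e` may be joined to the wired leaves, so the separation is made on the
upper side: the parent of `e` is enclosed below the missing stem edge, in a part of the block
without wired leaves. -/
theorem not_reachable_of_stem_closed {L B : Config (binaryTree h)}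
    (hL : L ⊆ Set.range (φ.leafEdge hℓ hℓh)) (e : (binaryTree h).edgeSet) (heB : e ∉ B)
    (he : e ∉ Set.range (φ.leafEdge hℓ hℓh))
    (i : G.edgeSet) (hi : treeChild e = φ.mid hℓ hℓh i) (j : Fin (ℓ - 1))
    (hje : φ.stemEdge hℓh (i, j) ≠ e) (hj : φ.stemEdge hℓh (i, j) ∉ B) :
    ¬ (openGraph (binaryTree h) (φ.boundary hℓ) (L ∪ B)).Reachable
      (treeParent e) (treeChild e) := by
  have hjℓ := j.2
  set u := φ.base i / 2 ^ ((j : ℕ) + 1) with hu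
  have hiv : (treeChild e : ℕ) = φ.base i / 2 := by rw [hi, mid_val]
  -- The stem edge of index `0` is `e` itself; the missing one is therefore higher up, and the
  -- parent of `e` lies below it.
  have hj0 : (j : ℕ) ≠ 0 := by
    intro h0
    apply hje
    apply treeChild_injective
    apply Subtype.ext
    rw [treeChild_stemEdge, hiv, h0]
    simp
  have hmidlt := φ.mid_lt hℓ hℓh i
  have hmv := φ.mid_val hℓ hℓh i
  have h2 := two_le_treeChild e
  have hpv := treeParent_val e
  have hleaf : ∀ w : TreeVertex h, (w : ℕ) / 2 = φ.mid hℓ hℓh i ↔ ∃ b, w = φ.leaf hℓ hℓh (i, b) := by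
    intro w
    constructor
    · intro hw
      have h3 := φ.two_dvd_base hℓ hℓh i
      have h4 : (w : ℕ) = φ.base i ∨ (w : ℕ) = φ.base i + 1 := by omega
      rcases h4 with h4 | h4
      · exact ⟨false, Subtype.ext (by rw [leaf_val]; exact h4)⟩
      · exact ⟨true, Subtype.ext (by rw [leaf_val]; exact h4)⟩
    · rintro ⟨b, rfl⟩
      rw [leaf_val, mid_val, φ.base_add_div hℓ hℓh]
  -- The descendants of `u` without the middle vertex and its two leaves: the exit upwards is the
  -- missing stem edge, the one downwards is `e`, and the only wired leaves below `u` are the two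
  -- that were removed.
  refine SimpleGraph.not_reachable_of_closed
    {w : TreeVertex h | (∃ k, (w : ℕ) / 2 ^ k = u) ∧ (∀ b, w ≠ φ.leaf hℓ hℓh (i, b)) ∧
      w ≠ φ.mid hℓ hℓh i} ?_ ?_ ?_
  · rintro x ⟨⟨k, hk⟩, hxl, hxm⟩ y hxy
    rcases openGraph_binaryTree_adj hxy with ⟨f, hf, ⟨rfl, rfl⟩ | ⟨rfl, rfl⟩⟩ | ⟨hne, hξ⟩
    · refine ⟨⟨k + 1, ?_⟩, ?_, ?_⟩
      · rw [pow_succ' 2 k, ← Nat.div_div_eq_div_mul, ← treeParent_val, hk]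
      · intro b hb
        apply hxm
        apply Subtype.ext
        rw [treeParent_val]
        exact (hleaf _).2 ⟨b, hb⟩
      · intro hm
        rw [← hi] at hm
        obtain rfl := treeChild_injective hm
        rcases hf with hf | hf
        · exact he (hL hf)
        · exact heB hf
    · have hk0 : k ≠ 0 := by
        rintro rfl
        rw [pow_zero, Nat.div_one] at hk
        have hfs : f = φ.stemEdge hℓh (i, j) := by
          apply treeChild_injective
          apply Subtype.ext
          rw [hk, treeChild_stemEdge]
        rcases hf with hf | hf
        · obtain ⟨k', hk'⟩ := hL hf
          exact φ.stemEdge_ne_leafEdge hℓ hℓh (i, j) k' (hfs.symm.trans hk'.symm)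
        · exact hj (hfs ▸ hf)
      have hpf := treeParent_val f
      have hcf := (Finset.mem_Ico.1 (treeChild f).2).2
      refine ⟨⟨k - 1, ?_⟩, ?_, ?_⟩
      · rw [hpf, Nat.div_div_eq_div_mul, ← pow_succ', Nat.sub_add_cancel (by omega), hk]
      · intro b hb
        have h3 := φ.le_leaf hℓ hℓh (i, b)
        rw [← hb] at h3
        omega
      · intro hm
        obtain ⟨b, hb⟩ := (hleaf (treeChild f)).1 (by rw [← hpf, hm])
        exact hxl b hb
    · obtain ⟨m, m', rfl, rfl, -⟩ := (φ.boundary_leaf_iff hℓ hℓh hne).1 hξ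
      exfalso
      rw [leaf_val] at hk
      obtain ⟨h3, -⟩ := φ.block_unique hℓ hℓh i m (j := (j : ℕ) + 1) (by omega) hk
      exact hxl m.2 (by rw [← h3])
  · refine ⟨⟨(j : ℕ) - 1, ?_⟩, ?_, ?_⟩
    · rw [hpv, hiv, hu, Nat.div_div_eq_div_mul, Nat.div_div_eq_div_mul, ← pow_succ', ← pow_succ']
      congr 2
      omega
    · intro b hb
      have h3 := φ.le_leaf hℓ hℓh (i, b)
      rw [← hb] at h3
      rw [← hi] at hmidlt
      omega
    · intro hm
      have h3 := congrArg Subtype.val hm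
      rw [← hi] at h3
      omega
  · rintro ⟨-, -, h3⟩
    exact h3 hi

/-- Add the edges in the order of their child numbers: each joins two distinct components, by one of
the two separations above. Passing to a subset of `B` preserves the hypotheses. -/
theorem numComponents_union_le_of_stems_closed {L : Config (binaryTree h)}
    (hL : L ⊆ Set.range (φ.leafEdge hℓ hℓh)) (n : ℕ) :
    ∀ B : Config (binaryTree h), B.ncard = n →
      (∀ e ∈ B, e ∉ Set.range (φ.leafEdge hℓ hℓh)) →
      (∀ e ∈ B, ∀ i, treeChild e = φ.mid hℓ hℓh i → ∃ j, φ.stemEdge hℓh (i, j) ∉ B) →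
      numComponents (binaryTree h) (φ.boundary hℓ) (L ∪ B) + n ≤
        numComponents (binaryTree h) (φ.boundary hℓ) L := by
  induction n with
  | zero =>
    intro B hB _ _
    rw [(Set.ncard_eq_zero (Set.toFinite B)).1 hB]
    simp
  | succ n ih =>
    intro B hB hB' hgood
    obtain ⟨e, he, hmax⟩ := Set.exists_max_image B (fun e => (treeChild e : ℕ)) (Set.toFinite B)
      (Set.nonempty_of_ncard_ne_zero (by omega))
    have hins : insert e (B \ {e}) = B := by
      rw [Set.insert_sdiff_singleton, Set.insert_eq_of_mem he]
    have hcard : (B \ {e}).ncard = n := by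
      rw [Set.ncard_sdiff_singleton_of_mem he]
      omega
    have h1 := ih (B \ {e}) hcard (fun f hf => hB' f hf.1) (fun f hf i hi => by
      obtain ⟨j, hj⟩ := hgood f hf.1 i hi
      exact ⟨j, fun h2 => hj h2.1⟩)
    have h2 : ¬ (openGraph (binaryTree h) (φ.boundary hℓ) (L ∪ B \ {e})).Reachable
        (treeParent e) (treeChild e) := by
      by_cases hmid : ∃ i, treeChild e = φ.mid hℓ hℓh i
      · obtain ⟨i, hi⟩ := hmid
        obtain ⟨j, hj⟩ := hgood e he i hi
        exact φ.not_reachable_of_stem_closed hℓ hℓh hL e (fun h2 => h2.2 rfl) (hB' e he) i hi j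
          (fun h2 => hj (h2 ▸ he)) fun h2 => hj h2.1
      · exact φ.not_reachable_of_maximal hℓ hℓh hL e (hB' e he) (fun h2 => h2.2 rfl)
          (fun f hf => hmax f hf.1) fun i hi => hmid ⟨i, hi⟩
    have h3 := numComponents_insert_of_not_reachable _ e (treeEdge_eq e) h2
    rw [← Set.union_insert, hins] at h3
    omega

/-- The edges of `G` whose block is connected to its root. -/
def connected (A : Config (binaryTree h)) : Set G.edgeSet := {i | ∀ j, φ.stemEdge hℓh (i, j) ∈ A}

theorem numComponents_add_le [Finite V] (A : Config (binaryTree h)) :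
    numComponents (binaryTree h) (φ.boundary hℓ) A +
        (A \ Set.range (φ.leafEdge hℓ hℓh)).ncard ≤
      numComponents (binaryTree h) (φ.boundary hℓ) (A ∩ Set.range (φ.leafEdge hℓ hℓh)) +
        (φ.connected hℓh A).ncard := by
  set R := Set.range (φ.leafEdge hℓ hℓh) with hR
  set B := A \ R with hB
  -- For each block with a fully open stem, dropping the edge directly above its middle vertex makes
  -- the previous lemma applicable. At most one edge per such block is lost, and the dropped edges
  -- only lower the number of components.
  set B' : Config (binaryTree h) :=
    {e ∈ B | ¬ ∃ i ∈ φ.connected hℓh A, treeChild e = φ.mid hℓ hℓh i} with hB'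
  have h1 := φ.numComponents_union_le_of_stems_closed hℓ hℓh (L := A ∩ R) Set.inter_subset_right
    B'.ncard B' rfl (fun e he => he.1.2) (fun e he i hi => by
      by_contra! hcon
      exact he.2 ⟨i, fun j => (hcon j).1.1, hi⟩)
  have h2 : numComponents (binaryTree h) (φ.boundary hℓ) A ≤
      numComponents (binaryTree h) (φ.boundary hℓ) (A ∩ R ∪ B') := by
    refine numComponents_anti ?_
    rintro e (he | he)
    · exact he.1
    · exact he.1.1
  have h3 : (B \ B').ncard ≤ (φ.connected hℓh A).ncard := by
    rw [← Set.ncard_image_of_injective _ treeChild_injective]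
    refine le_trans (Set.ncard_le_ncard ?_ (Set.toFinite _))
      (Set.ncard_image_le (f := φ.mid hℓ hℓh) (Set.toFinite _))
    rintro _ ⟨e, ⟨he, he'⟩, rfl⟩
    by_contra hcon
    exact he' ⟨he, fun ⟨i, hi, hie⟩ => hcon ⟨i, hi, hie.symm⟩⟩
  have h4 : B.ncard ≤ B'.ncard + (B \ B').ncard := by
    rw [add_comm, Set.ncard_sdiff_add_ncard_of_subset (fun e he => he.1) (Set.toFinite _)]
  omega

theorem numComponents_le_add (A : Config (binaryTree h)) :
    numComponents (binaryTree h) (φ.boundary hℓ) (A ∩ Set.range (φ.leafEdge hℓ hℓh)) ≤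
      numComponents (binaryTree h) (φ.boundary hℓ) A +
        (A \ Set.range (φ.leafEdge hℓ hℓh)).ncard := by
  have := numComponents_le_union (ξ := φ.boundary hℓ) (A ∩ Set.range (φ.leafEdge hℓ hℓh))
    (A \ Set.range (φ.leafEdge hℓ hℓh))
  rwa [Set.inter_union_sdiff] at this

end TreeEmbedding

/-! ### Product measures on subsets and the exponential moment of open stems -/

section SubsetSums

open scoped Classical in
theorem Fintype.prod_ite_mem_set {R : Type*} [Fintype R] (S : Set R) (a b : ℝ) :
    ∏ r, (if r ∈ S then a else b) = a ^ S.ncard * b ^ Sᶜ.ncard := by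
  rw [Finset.prod_ite, Finset.prod_const, Finset.prod_const, Set.ncard_eq_toFinset_card',
    Set.ncard_eq_toFinset_card']
  congr 3 <;> ext <;> simp

open scoped Classical in
theorem Fintype.sum_set_prod {R : Type*} [Fintype R] [Fintype (Set R)] (f g : R → ℝ) :
    ∑ B : Set R, ∏ r, (if r ∈ B then f r else g r) = ∏ r, (f r + g r) := by
  rw [Finset.prod_add, Finset.powerset_univ]
  refine (Fintype.sum_equiv Fintype.finsetEquivSet _ _ fun B => ?_).symm
  rw [← Finset.prod_sdiff (Finset.subset_univ B), mul_comm]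
  congr 1
  · refine Finset.prod_congr rfl fun r hr => ?_
    rw [if_neg]
    simpa using hr
  · refine Finset.prod_congr rfl fun r hr => ?_
    rw [if_pos]
    simpa using hr

open scoped Classical in
/-- In a product measure on subsets, the probability to contain `S` is at most `p ^ |S|`. -/
theorem sum_set_prod_superset_le {R : Type*} [Fintype R] [Fintype (Set R)] (S : Finset R)
    {p x y : ℝ} (hx : 0 ≤ x) (hy : 0 ≤ y) (hxy : x ≤ p * (x + y)) :
    (∑ B : Set R, (∏ r, (if r ∈ B then x else y)) * if (S : Set R) ⊆ B then 1 else 0) ≤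
      p ^ S.card * (x + y) ^ Fintype.card R := by
  have h1 : ∀ B : Set R, (∏ r, (if r ∈ B then x else y)) * (if (S : Set R) ⊆ B then 1 else 0) =
      ∏ r, (if r ∈ B then x else if r ∈ S then 0 else y) := by
    intro B
    split_ifs with hB
    · rw [mul_one]
      refine Finset.prod_congr rfl fun r _ => ?_
      by_cases hr : r ∈ B
      · simp [hr]
      · have : r ∉ S := fun h => hr (hB h)
        simp [hr, this]
    · obtain ⟨r, hr, hrB⟩ := Set.not_subset.1 hB
      rw [mul_zero]
      refine (Finset.prod_eq_zero (Finset.mem_univ r) ?_).symm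
      have : r ∈ S := hr
      simp [hrB, this]
  simp only [h1]
  rw [Fintype.sum_set_prod (fun _ => x) (fun r => if r ∈ S then 0 else y)]
  -- An element of `S` must be present and contributes `x ≤ p * (x + y)`; any other contributes the
  -- full `x + y`.
  calc ∏ r, (x + if r ∈ S then 0 else y) ≤ ∏ r, ((if r ∈ S then p else 1) * (x + y)) := by
        refine Finset.prod_le_prod (fun r _ => ?_) fun r _ => ?_
        · split_ifs <;> positivity
        · split_ifs <;> linarith
    _ = p ^ S.card * (x + y) ^ Fintype.card R := by
        rw [Finset.prod_mul_distrib, Finset.prod_const, Finset.card_univ, Finset.prod_ite]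
        simp

open scoped Classical in
/-- The exponential moment of the number of fully open stems in a product measure. -/
theorem sum_set_prod_stems_le {R I : Type*} [Fintype R] [Fintype I] [Fintype (Set R)] {n : ℕ}
    (st : I × Fin n → R) (hst : Function.Injective st) {p x y q : ℝ} (hx : 0 ≤ x) (hy : 0 ≤ y)
    (hxy : x ≤ p * (x + y)) (hq : 1 ≤ q) :
    (∑ B : Set R, (∏ r, (if r ∈ B then x else y)) *
      ∏ i, (if ∀ j, st (i, j) ∈ B then q else 1)) ≤
      (1 + (q - 1) * p ^ n) ^ Fintype.card I * (x + y) ^ Fintype.card R := by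
  -- Expanding each `q` as `1 + (q - 1)` turns the product into a sum over the sets `J` of indices
  -- with all stems open.
  have h1 : ∀ B : Set R, ∏ i, (if ∀ j, st (i, j) ∈ B then q else 1) =
      ∑ J : Finset I, (q - 1) ^ J.card *
        if (((J ×ˢ Finset.univ).image st : Finset R) : Set R) ⊆ B then 1 else 0 := by
    intro B
    have h2 : ∀ i, (if ∀ j, st (i, j) ∈ B then q else 1) =
        1 + (if ∀ j, st (i, j) ∈ B then q - 1 else 0) := by
      intro i
      split_ifs <;> ring
    simp only [h2]
    rw [Finset.prod_one_add, Finset.powerset_univ]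
    refine Finset.sum_congr rfl fun J _ => ?_
    have h3 : (((J ×ˢ Finset.univ).image st : Finset R) : Set R) ⊆ B ↔
        ∀ i ∈ J, ∀ j, st (i, j) ∈ B := by
      constructor
      · intro h i hi j
        exact h (Finset.mem_coe.2 (Finset.mem_image_of_mem st
          (Finset.mem_product.2 ⟨hi, Finset.mem_univ j⟩)))
      · intro h r hr
        obtain ⟨⟨i, j⟩, hk, rfl⟩ := Finset.mem_image.1 (Finset.mem_coe.1 hr)
        exact h i (Finset.mem_product.1 hk).1 j
    rw [Finset.prod_ite_zero, Finset.prod_const]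
    simp only [h3, mul_ite, mul_one, mul_zero]
    congr
  simp only [h1, Finset.mul_sum]
  rw [Finset.sum_comm]
  have h4 : ∀ J : Finset I, ∑ B : Set R, (∏ r, (if r ∈ B then x else y)) * ((q - 1) ^ J.card *
      if (((J ×ˢ Finset.univ).image st : Finset R) : Set R) ⊆ B then 1 else 0) ≤
      (∏ _i ∈ J, (q - 1) * p ^ n) * (x + y) ^ Fintype.card R := by
    intro J
    -- Stems are disjoint, so those of `J` comprise `|J| * n` elements.
    have h5 := sum_set_prod_superset_le ((J ×ˢ Finset.univ).image st) hx hy hxy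
    rw [Finset.card_image_of_injective _ hst, Finset.card_product, Finset.card_univ,
      Fintype.card_fin] at h5
    calc _ = (q - 1) ^ J.card * ∑ B : Set R, (∏ r, (if r ∈ B then x else y)) *
          (if (((J ×ˢ Finset.univ).image st : Finset R) : Set R) ⊆ B then 1 else 0) := by
          rw [Finset.mul_sum]
          exact Finset.sum_congr rfl fun B _ => by ring
      _ ≤ (q - 1) ^ J.card * (p ^ (J.card * n) * (x + y) ^ Fintype.card R) :=
          mul_le_mul_of_nonneg_left h5 (pow_nonneg (by linarith) _)
      _ = _ := by
          rw [Finset.prod_const, mul_pow, ← pow_mul, mul_comm n]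
          ring
  refine (Finset.sum_le_sum fun J _ => h4 J).trans (le_of_eq ?_)
  rw [← Finset.sum_mul, ← Finset.powerset_univ, ← Finset.prod_one_add, Finset.prod_const,
    Finset.card_univ]

end SubsetSums

/-! ### Separation of the leaf edges from the other edges -/

section Split

variable {E I : Type*} (ed : I × Bool → E)

open scoped Classical in
/-- A set of edges is given by its leaf edges, sorted by blocks, and its other edges. -/
noncomputable def splitConfig (A : Set E) : (I → Bool × Bool) × Set {e // e ∉ Set.range ed} :=
  (fun i => (decide (ed (i, false) ∈ A), decide (ed (i, true) ∈ A)), Subtype.val ⁻¹' A)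

variable {ed}

theorem splitConfig_bijective (hed : Function.Injective ed) :
    Function.Bijective (splitConfig ed) := by
  classical
  constructor
  · intro A B hAB
    have h1 := congrArg Prod.fst hAB
    have h2 := congrArg Prod.snd hAB
    ext e
    by_cases he : e ∈ Set.range ed
    · obtain ⟨⟨i, b⟩, rfl⟩ := he
      have h3 := congrFun h1 i
      simp only [splitConfig, Prod.mk.injEq, decide_eq_decide] at h3
      cases b
      · exact h3.1
      · exact h3.2
    · exact Set.ext_iff.1 h2 ⟨e, he⟩
  · rintro ⟨s, B⟩
    refine ⟨{e | (∃ i, e = ed (i, false) ∧ (s i).1 = true) ∨ (∃ i, e = ed (i, true) ∧ (s i).2 = true) ∨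
      ∃ he : e ∉ Set.range ed, (⟨e, he⟩ : {e // e ∉ Set.range ed}) ∈ B}, ?_⟩
    refine Prod.ext ?_ ?_
    · funext i
      simp only [splitConfig, Set.mem_ofPred_eq, hed.eq_iff, Prod.mk.injEq]
      refine Prod.ext ?_ ?_ <;> simp
    · ext ⟨e, he⟩
      have h1 : ∀ k, e ≠ ed k := fun k hk => he ⟨k, hk.symm⟩
      simp only [splitConfig, Set.mem_preimage, Set.mem_ofPred_eq, h1, false_and, exists_false,
        false_or]
      exact ⟨fun h => h.2, fun h => ⟨he, h⟩⟩

open scoped Classical in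
theorem sum_splitConfig [Fintype I] [Fintype (Set E)] [Fintype (Set {e // e ∉ Set.range ed})]
    (hed : Function.Injective ed) (F : (I → Bool × Bool) → ℝ)
    (H : Set {e // e ∉ Set.range ed} → ℝ) :
    ∑ A : Set E, F (splitConfig ed A).1 * H (splitConfig ed A).2 = (∑ s, F s) * ∑ B, H B := by
  rw [Fintype.sum_mul_sum, ← Fintype.sum_prod_type' (fun s B => F s * H B)]
  exact Fintype.sum_bijective _ (splitConfig_bijective hed) _ _ fun A => rfl

open scoped Classical in
theorem prod_split [Fintype E] [Fintype I] (hed : Function.Injective ed) (f : E → ℝ) :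
    ∏ e, f e = (∏ i, f (ed (i, false)) * f (ed (i, true))) *
      ∏ r : {e // e ∉ Set.range ed}, f r := by
  rw [← Fintype.prod_subtype_mul_prod_subtype (fun e => e ∈ Set.range ed) f]
  congr 1
  have key : ∏ k, f (ed k) = ∏ r : Set.range ed, f r :=
    Fintype.prod_equiv (Equiv.ofInjective ed hed) _ _ fun _ => rfl
  refine Eq.trans (b := ∏ k, f (ed k)) (by convert key.symm) ?_
  rw [Fintype.prod_prod_type]
  refine Finset.prod_congr rfl fun i _ => ?_
  rw [Fintype.prod_bool, mul_comm]

end Split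

/-! ### Comparison of the projected tree measure with the measure on `G` -/

namespace TreeEmbedding

open RandomCluster

variable {V : Type*} {G : SimpleGraph V} {h ℓ : ℕ} (φ : TreeEmbedding G h ℓ) (hℓ : 0 < ℓ)
  (hℓh : ℓ ≤ h)

/-- The exact count for leaf edges, combined with the fact that each remaining open edge removes one
component, up to an error of one per connected block. Written additively to avoid subtraction. -/
theorem numComponents_bounds [Finite V] (A : Config (binaryTree h)) :
    numComponents (binaryTree h) (φ.boundary hℓ) ∅ + numComponents G ⊥ (φ.project hℓ hℓh A) ≤
      numComponents (binaryTree h) (φ.boundary hℓ) A +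
        (A \ Set.range (φ.leafEdge hℓ hℓh)).ncard +
        {i : G.edgeSet | ∃ b, φ.leafEdge hℓ hℓh (i, b) ∈ A}.ncard + numComponents G ⊥ ∅ ∧
    numComponents (binaryTree h) (φ.boundary hℓ) A +
        (A \ Set.range (φ.leafEdge hℓ hℓh)).ncard +
        {i : G.edgeSet | ∃ b, φ.leafEdge hℓ hℓh (i, b) ∈ A}.ncard + numComponents G ⊥ ∅ ≤
      numComponents (binaryTree h) (φ.boundary hℓ) ∅ + numComponents G ⊥ (φ.project hℓ hℓh A) +
        (φ.connected hℓh A).ncard := by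
  have h1 := φ.numComponents_leafEdges hℓ hℓh (φ.leafEdge hℓ hℓh ⁻¹' A)
  rw [Set.image_preimage_eq_inter_range] at h1
  have h2 := φ.numComponents_add_le hℓ hℓh A
  have h3 := φ.numComponents_le_add hℓ hℓh A
  have h4 : {i : G.edgeSet | ∀ b, (i, b) ∈ φ.leafEdge hℓ hℓh ⁻¹' A} = φ.project hℓ hℓh A := rfl
  have h5 : {i : G.edgeSet | ∃ b, (i, b) ∈ φ.leafEdge hℓ hℓh ⁻¹' A} =
    {i : G.edgeSet | ∃ b, φ.leafEdge hℓ hℓh (i, b) ∈ A} := rfl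
  rw [h4, h5] at h1
  omega

/-- The weight of the states of the two halves of an edge of `G`. -/
noncomputable def halvesWeight (p q : ℝ) (s : Bool × Bool) : ℝ :=
  (bif s.1 then p else 1 - p) * (bif s.2 then p else 1 - p) * (bif s.1 || s.2 then 1 / q else 1)

/-- The stem edges, as edges other than the leaf edges. -/
noncomputable def stem (k : G.edgeSet × Fin (ℓ - 1)) :
    {e // e ∉ Set.range (φ.leafEdge hℓ hℓh)} :=
  ⟨φ.stemEdge hℓh k, fun ⟨k', hk'⟩ => φ.stemEdge_ne_leafEdge hℓ hℓh k k' hk'.symm⟩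

theorem stem_injective : Function.Injective (φ.stem hℓ hℓh) := fun _ _ hk =>
  φ.stemEdge_injective hℓ hℓh (congrArg Subtype.val hk)

open scoped Classical in
-- A factor `1 / q` for each open non-leaf edge and for each touched block still leaves a product:
-- independent over blocks and over the remaining edges.
theorem bernoulli_split [Fintype V] (p q : ℝ) (A : Config (binaryTree h)) :
    p ^ A.ncard * (1 - p) ^ Aᶜ.ncard * (1 / q) ^ (A \ Set.range (φ.leafEdge hℓ hℓh)).ncard *
        (1 / q) ^ {i : G.edgeSet | ∃ b, φ.leafEdge hℓ hℓh (i, b) ∈ A}.ncard =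
      (∏ i, halvesWeight p q ((splitConfig (φ.leafEdge hℓ hℓh) A).1 i)) *
        ∏ r, (if r ∈ (splitConfig (φ.leafEdge hℓ hℓh) A).2 then p / q else 1 - p) := by
  have h1 : (A \ Set.range (φ.leafEdge hℓ hℓh)).ncard =
      (Subtype.val ⁻¹' A : Set {e // e ∉ Set.range (φ.leafEdge hℓ hℓh)}).ncard := by
    have himage : Subtype.val '' (Subtype.val ⁻¹' A :
        Set {e // e ∉ Set.range (φ.leafEdge hℓ hℓh)}) = A \ Set.range (φ.leafEdge hℓ hℓh) := by
      ext e
      constructor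
      · rintro ⟨x, hx, rfl⟩
        exact ⟨hx, x.2⟩
      · rintro ⟨he, he'⟩
        exact ⟨⟨e, he'⟩, he, rfl⟩
    rw [← himage, Set.ncard_image_of_injective _ Subtype.val_injective]
  have h2 : (1 / q) ^ (Subtype.val ⁻¹' A : Set {e // e ∉ Set.range (φ.leafEdge hℓ hℓh)}).ncard =
      ∏ r : {e // e ∉ Set.range (φ.leafEdge hℓ hℓh)}, (if r.1 ∈ A then 1 / q else 1) := by
    have := Fintype.prod_ite_mem_set
      (Subtype.val ⁻¹' A : Set {e // e ∉ Set.range (φ.leafEdge hℓ hℓh)}) (1 / q) 1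
    rw [one_pow, mul_one] at this
    exact this.symm
  have h3 : (1 / q) ^ {i : G.edgeSet | ∃ b, φ.leafEdge hℓ hℓh (i, b) ∈ A}.ncard =
      ∏ i : G.edgeSet, (if ∃ b, φ.leafEdge hℓ hℓh (i, b) ∈ A then 1 / q else 1) := by
    have := Fintype.prod_ite_mem_set
      {i : G.edgeSet | ∃ b, φ.leafEdge hℓ hℓh (i, b) ∈ A} (1 / q) 1
    rw [one_pow, mul_one] at this
    convert this.symm
    exact Iff.rfl
  have h4 : ∀ i, halvesWeight p q ((splitConfig (φ.leafEdge hℓ hℓh) A).1 i) =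
      (if φ.leafEdge hℓ hℓh (i, false) ∈ A then p else 1 - p) *
        (if φ.leafEdge hℓ hℓh (i, true) ∈ A then p else 1 - p) *
        (if ∃ b, φ.leafEdge hℓ hℓh (i, b) ∈ A then 1 / q else 1) := by
    intro i
    simp only [halvesWeight, splitConfig, Bool.exists_bool]
    by_cases hx : φ.leafEdge hℓ hℓh (i, false) ∈ A <;>
      by_cases hy : φ.leafEdge hℓ hℓh (i, true) ∈ A <;> simp [hx, hy]
  have h5 : ∀ r : {e // e ∉ Set.range (φ.leafEdge hℓ hℓh)},
      (if r ∈ (splitConfig (φ.leafEdge hℓ hℓh) A).2 then p / q else 1 - p) =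
      (if r.1 ∈ A then p else 1 - p) * (if r.1 ∈ A then 1 / q else 1) := by
    intro r
    simp only [splitConfig, Set.mem_preimage]
    split_ifs <;> ring
  have h6 : ∏ e, (if e ∈ A then p else 1 - p) =
      (∏ i, (if φ.leafEdge hℓ hℓh (i, false) ∈ A then p else 1 - p) *
        (if φ.leafEdge hℓ hℓh (i, true) ∈ A then p else 1 - p)) *
        ∏ r : {e // e ∉ Set.range (φ.leafEdge hℓ hℓh)}, (if r.1 ∈ A then p else 1 - p) := by
    rw [prod_split (φ.leafEdge_injective hℓ hℓh)]
    congr!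
  rw [Finset.prod_congr rfl fun i _ => h4 i, Finset.prod_congr rfl fun r _ => h5 r, h1, h2, h3,
    ← Fintype.prod_ite_mem_set, h6]
  simp only [Finset.prod_mul_distrib]
  ring

/-- The total weight of the states of the two halves that lead to a given state of the edge. -/
theorem sum_halvesWeight {p q : ℝ} (P : Prop) [Decidable P] :
    (∑ s : Bool × Bool, if ((s.1 && s.2) = true ↔ P) then halvesWeight p q s else 0) =
      if P then p ^ 2 / q else (1 - p) ^ 2 + 2 * p * (1 - p) / q := by
  rw [Fintype.sum_prod_type]
  simp only [Fintype.sum_bool, halvesWeight]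
  by_cases hP : P <;> simp [hP] <;> ring

theorem mem_project_iff (A : Config (binaryTree h)) (i : G.edgeSet) :
    i ∈ φ.project hℓ hℓh A ↔ (((splitConfig (φ.leafEdge hℓ hℓh) A).1 i).1 &&
      ((splitConfig (φ.leafEdge hℓ hℓh) A).1 i).2) = true := by
  simp [project, splitConfig, Bool.forall_bool]

open scoped Classical in
theorem prod_halvesWeight_indicator [Fintype V] (p q : ℝ) (η : Config G)
    (A : Config (binaryTree h)) :
    (∏ i, if ((((splitConfig (φ.leafEdge hℓ hℓh) A).1 i).1 &&
        ((splitConfig (φ.leafEdge hℓ hℓh) A).1 i).2) = true ↔ i ∈ η) then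
        halvesWeight p q ((splitConfig (φ.leafEdge hℓ hℓh) A).1 i) else 0) =
      if φ.project hℓ hℓh A = η then
        ∏ i, halvesWeight p q ((splitConfig (φ.leafEdge hℓ hℓh) A).1 i) else 0 := by
  simp only [← φ.mem_project_iff hℓ hℓh]
  rw [Finset.prod_ite_zero]
  simp only [Finset.mem_univ, true_implies, Set.ext_iff]

open scoped Classical in
-- The series law: per edge, the open and the closed total are in the ratio `p : 1 - p`, and their
-- sum is the base of the first power.
theorem sum_prod_halvesWeight [Fintype V] {p p' q : ℝ} (hq : 1 < q) (hp0 : 0 < p') (hp1 : p' < 1)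
    (hp : p = p' ^ 2 / (p' ^ 2 + 2 * p' * (1 - p') + (1 - p') ^ 2 * q)) (η : Config G) :
    (∑ s : G.edgeSet → Bool × Bool, ∏ i, if (((s i).1 && (s i).2) = true ↔ i ∈ η) then
        halvesWeight p' q (s i) else 0) =
      (p' ^ 2 / q + ((1 - p') ^ 2 + 2 * p' * (1 - p') / q)) ^ Fintype.card G.edgeSet *
        (p ^ η.ncard * (1 - p) ^ ηᶜ.ncard) := by
  have h1 : 0 < 1 - p' := by linarith
  have h2 : 0 < q := by linarith
  have h3 : 0 < p' ^ 2 + 2 * p' * (1 - p') + (1 - p') ^ 2 * q := by positivity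
  have h4 := (Finset.prod_univ_sum (fun _ : G.edgeSet => (Finset.univ : Finset (Bool × Bool)))
    (fun i s => if ((s.1 && s.2) = true ↔ i ∈ η) then halvesWeight p' q s else 0))
  rw [Fintype.piFinset_univ] at h4
  rw [← h4, ← Fintype.prod_ite_mem_set, ← Finset.card_univ, ← Finset.prod_const,
    ← Finset.prod_mul_distrib]
  refine Finset.prod_congr rfl fun i _ => ?_
  have hD : p' ^ 2 / q + ((1 - p') ^ 2 + 2 * p' * (1 - p') / q) =
      (p' ^ 2 + 2 * p' * (1 - p') + (1 - p') ^ 2 * q) / q := by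
    field_simp
    ring
  rw [sum_halvesWeight, hD, hp]
  generalize hZ : p' ^ 2 + 2 * p' * (1 - p') + (1 - p') ^ 2 * q = Z at *
  split_ifs
  · field_simp
  · field_simp
    rw [← hZ]
    ring

open scoped Classical in
theorem weight_bounds [Fintype V] {p q : ℝ} (hq : 1 < q) (hp0 : 0 < p) (hp1 : p < 1)
    (A : Config (binaryTree h)) :
    (q ^ numComponents (binaryTree h) (φ.boundary hℓ) ∅ / q ^ numComponents G ⊥ ∅) *
        q ^ numComponents G ⊥ (φ.project hℓ hℓh A) *
        ((∏ i, halvesWeight p q ((splitConfig (φ.leafEdge hℓ hℓh) A).1 i)) *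
        ∏ r, (if r ∈ (splitConfig (φ.leafEdge hℓ hℓh) A).2 then p / q else 1 - p)) ≤
      weight (binaryTree h) (φ.boundary hℓ) p q A ∧
    weight (binaryTree h) (φ.boundary hℓ) p q A ≤
      (q ^ numComponents (binaryTree h) (φ.boundary hℓ) ∅ / q ^ numComponents G ⊥ ∅) *
        q ^ numComponents G ⊥ (φ.project hℓ hℓh A) *
        ((∏ i, halvesWeight p q ((splitConfig (φ.leafEdge hℓ hℓh) A).1 i)) *
        (∏ r, (if r ∈ (splitConfig (φ.leafEdge hℓ hℓh) A).2 then p / q else 1 - p)) *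
        ∏ i, (if ∀ j, φ.stem hℓ hℓh (i, j) ∈ (splitConfig (φ.leafEdge hℓ hℓh) A).2
          then q else 1)) := by
  have hconn : ∏ i, (if ∀ j, φ.stem hℓ hℓh (i, j) ∈ (splitConfig (φ.leafEdge hℓ hℓh) A).2
      then q else 1) = q ^ (φ.connected hℓh A).ncard := by
    have := Fintype.prod_ite_mem_set (φ.connected hℓh A) q 1
    rw [one_pow, mul_one] at this
    convert this
    exact Iff.rfl
  obtain ⟨h1, h2⟩ := φ.numComponents_bounds hℓ hℓh A
  rw [hconn, ← bernoulli_split, weight]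
  generalize (A \ Set.range (φ.leafEdge hℓ hℓh)).ncard = b at *
  generalize {i : G.edgeSet | ∃ b, φ.leafEdge hℓ hℓh (i, b) ∈ A}.ncard = t at *
  generalize (φ.connected hℓh A).ncard = k at *
  generalize numComponents (binaryTree h) (φ.boundary hℓ) ∅ = c0 at *
  generalize numComponents (binaryTree h) (φ.boundary hℓ) A = c at *
  generalize numComponents G ⊥ ∅ = g0 at *
  generalize numComponents G ⊥ (φ.project hℓ hℓh A) = g at *
  have hq0 : 0 < q := by linarith
  have h1p : 0 < 1 - p := by linarith
  have hw : 0 < p ^ A.ncard * (1 - p) ^ Aᶜ.ncard := by positivity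
  generalize p ^ A.ncard * (1 - p) ^ Aᶜ.ncard = w at *
  have h3 : q ^ (c0 + g) ≤ q ^ (c + b + t + g0) := pow_le_pow_right₀ hq.le h1
  have h4 : q ^ (c + b + t + g0) ≤ q ^ (c0 + g + k) := pow_le_pow_right₀ hq.le h2
  simp only [pow_add] at h3 h4
  have hD : 0 < q ^ b * q ^ t * q ^ g0 := by positivity
  constructor
  · have h5 : q ^ c0 / q ^ g0 * q ^ g * (w * (1 / q) ^ b * (1 / q) ^ t) =
        w * (q ^ c0 * q ^ g / (q ^ b * q ^ t * q ^ g0)) := by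
      rw [one_div, inv_pow, inv_pow]
      field_simp
    rw [h5]
    refine mul_le_mul_of_nonneg_left ?_ hw.le
    rw [div_le_iff₀ hD]
    linarith
  · have h5 : q ^ c0 / q ^ g0 * q ^ g * (w * (1 / q) ^ b * (1 / q) ^ t * q ^ k) =
        w * (q ^ c0 * q ^ g * q ^ k / (q ^ b * q ^ t * q ^ g0)) := by
      rw [one_div, inv_pow, inv_pow]
      field_simp
    rw [h5]
    refine mul_le_mul_of_nonneg_left ?_ hw.le
    rw [le_div_iff₀ hD]
    linarith

open scoped Classical in
/-- The random-cluster measure of the tree, projected to `G`, is comparable with the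
random-cluster measure of `G`. -/
theorem exists_comparison [Fintype V] {p p' q : ℝ} (hq : 1 < q) (hp0 : 0 < p') (hp1 : p' < 1)
    (hp : p = p' ^ 2 / (p' ^ 2 + 2 * p' * (1 - p') + (1 - p') ^ 2 * q)) :
    ∃ C : ℝ, 0 < C ∧ ∀ η : Config G,
      C * weight G ⊥ p q η ≤ (∑ A : Config (binaryTree h), if φ.project hℓ hℓh A = η then
        weight (binaryTree h) (φ.boundary hℓ) p' q A else 0) ∧
      (∑ A : Config (binaryTree h), if φ.project hℓ hℓh A = η then
        weight (binaryTree h) (φ.boundary hℓ) p' q A else 0) ≤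
        C * (1 + (q - 1) * p' ^ (ℓ - 1)) ^ Fintype.card G.edgeSet * weight G ⊥ p q η := by
  have h1 : 0 < 1 - p' := by linarith
  have h2 : 0 < q := by linarith
  set R := {e // e ∉ Set.range (φ.leafEdge hℓ hℓh)} with hR
  set K := q ^ numComponents (binaryTree h) (φ.boundary hℓ) ∅ / q ^ numComponents G ⊥ ∅ with hK
  set D := (p' ^ 2 / q + ((1 - p') ^ 2 + 2 * p' * (1 - p') / q)) ^ Fintype.card G.edgeSet with hD
  set β := (p' / q + (1 - p')) ^ Fintype.card R with hβ
  set F : Config G → (G.edgeSet → Bool × Bool) → ℝ := fun η s =>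
    ∏ i, if (((s i).1 && (s i).2) = true ↔ i ∈ η) then halvesWeight p' q (s i) else 0 with hF
  set H : Set R → ℝ := fun B => ∏ r, (if r ∈ B then p' / q else 1 - p') with hH
  set Q : Set R → ℝ := fun B => ∏ i, (if ∀ j, φ.stem hℓ hℓh (i, j) ∈ B then q else 1) with hQ
  have hK0 : 0 < K := by positivity
  have hD0 : 0 < D := by positivity
  have hβ0 : 0 < β := by positivity
  have hHsum : ∑ B, H B = β := by
    rw [hβ, ← Finset.card_univ, ← Finset.prod_const]
    exact Fintype.sum_set_prod (fun _ => p' / q) (fun _ => 1 - p')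
  have hHQsum : ∑ B, H B * Q B ≤ (1 + (q - 1) * p' ^ (ℓ - 1)) ^ Fintype.card G.edgeSet * β := by
    refine sum_set_prod_stems_le (φ.stem hℓ hℓh) (φ.stem_injective hℓ hℓh) (by positivity) h1.le
      ?_ hq.le
    -- The normalised density `(p' / q) / (p' / q + 1 - p')` is at most `p'` because `q > 1`.
    rw [div_le_iff₀ h2]
    have : p' * (p' / q + (1 - p')) * q = p' * (p' + (1 - p') * q) := by field_simp
    rw [this]
    nlinarith [mul_pos hp0 (mul_pos h1 (sub_pos.2 hq))]
  have hFsum : ∀ η, ∑ s, F η s = D * (p ^ η.ncard * (1 - p) ^ ηᶜ.ncard) := fun η =>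
    sum_prod_halvesWeight hq hp0 hp1 hp η
  have hpp : 0 ≤ p ∧ 0 ≤ 1 - p := by
    have h3 : 0 < p' ^ 2 + 2 * p' * (1 - p') + (1 - p') ^ 2 * q := by positivity
    rw [hp]
    refine ⟨by positivity, ?_⟩
    rw [sub_nonneg, div_le_one h3]
    nlinarith [mul_pos hp0 h1, mul_pos (pow_pos h1 2) h2]
  have hFA : ∀ η A, F η (splitConfig (φ.leafEdge hℓ hℓh) A).1 = if φ.project hℓ hℓh A = η then
      ∏ i, halvesWeight p' q ((splitConfig (φ.leafEdge hℓ hℓh) A).1 i) else 0 := fun η A =>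
    φ.prod_halvesWeight_indicator hℓ hℓh p' q η A
  refine ⟨K * D * β, by positivity, fun η => ⟨?_, ?_⟩⟩
  · calc K * D * β * weight G ⊥ p q η
        = K * q ^ numComponents G ⊥ η * ((∑ s, F η s) * ∑ B, H B) := by
          rw [hFsum, hHsum, weight]; ring
      _ = ∑ A : Config (binaryTree h), K * q ^ numComponents G ⊥ η *
          (F η (splitConfig (φ.leafEdge hℓ hℓh) A).1 *
            H (splitConfig (φ.leafEdge hℓ hℓh) A).2) := by
          rw [← Finset.mul_sum, sum_splitConfig (φ.leafEdge_injective hℓ hℓh)]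
          congr!
      _ ≤ _ := by
          refine Finset.sum_le_sum fun A _ => ?_
          rw [hFA]
          split_ifs with hA
          · have := (φ.weight_bounds hℓ hℓh hq hp0 hp1 A).1
            rw [hA] at this
            exact this
          · simp
  · calc _ ≤ ∑ A : Config (binaryTree h), K * q ^ numComponents G ⊥ η *
          (F η (splitConfig (φ.leafEdge hℓ hℓh) A).1 *
            (H (splitConfig (φ.leafEdge hℓ hℓh) A).2 *
            Q (splitConfig (φ.leafEdge hℓ hℓh) A).2)) := by
          refine Finset.sum_le_sum fun A _ => ?_
          rw [hFA]
          split_ifs with hA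
          · have := (φ.weight_bounds hℓ hℓh hq hp0 hp1 A).2
            rw [hA, mul_assoc (∏ i : G.edgeSet, _)] at this
            exact this
          · simp
      _ = K * q ^ numComponents G ⊥ η * ((∑ s, F η s) * ∑ B, H B * Q B) := by
          rw [← Finset.mul_sum, sum_splitConfig (φ.leafEdge_injective hℓ hℓh) (F η)
            (fun B => H B * Q B)]
          congr!
      _ ≤ K * q ^ numComponents G ⊥ η * ((D * (p ^ η.ncard * (1 - p) ^ ηᶜ.ncard)) *
          ((1 + (q - 1) * p' ^ (ℓ - 1)) ^ Fintype.card G.edgeSet * β)) := by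
          rw [hFsum]
          refine mul_le_mul_of_nonneg_left (mul_le_mul_of_nonneg_left hHQsum ?_) ?_
          · exact mul_nonneg hD0.le (mul_nonneg (pow_nonneg hpp.1 _) (pow_nonneg hpp.2 _))
          · exact mul_nonneg hK0.le (pow_nonneg h2.le _)
      _ = _ := by
          rw [weight]; ring

end TreeEmbedding

/-! ### The spectral gap on the tree -/

namespace TreeEmbedding

open RandomCluster

variable {V : Type*} {G : SimpleGraph V} {h ℓ : ℕ} (φ : TreeEmbedding G h ℓ) (hℓ : 0 < ℓ)

theorem nonempty_of_card_lt [Finite V] (G : SimpleGraph V) (h ℓ : ℕ)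
    (hcard : Nat.card G.edgeSet < 2 ^ (h - ℓ)) : Nonempty (TreeEmbedding G h ℓ) := by
  have := Fintype.ofFinite G.edgeSet
  obtain ⟨f⟩ : Nonempty (G.edgeSet ↪ Fin (2 ^ (h - ℓ))) :=
    Function.Embedding.nonempty_of_card_le
      (by rw [Fintype.card_fin, ← Nat.card_eq_fintype_card]; exact hcard.le)
  have hends : ∀ e : G.edgeSet, ∃ u v, s(u, v) = (e : Sym2 V) := fun e =>
    Sym2.ind (f := fun z => ∃ u v, s(u, v) = z) (fun u v => ⟨u, v, rfl⟩) _
  choose l r hlr using hends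
  exact ⟨⟨f, l, r, hlr⟩⟩

/-- The spectral gap on the tree, in terms of the spectral gap on `G`. -/
theorem edgeGap_le [Fintype V] {p p' q : ℝ} (hq : 1 < q) (hp0 : 0 < p') (hp1 : p' < 1)
    (hpp0 : 0 < p) (hpp1 : p < 1)
    (hp : p = p' ^ 2 / (p' ^ 2 + 2 * p' * (1 - p') + (1 - p') ^ 2 * q)) (ε : ℝ) (hε : ε < 1)
    [Nonempty G.edgeSet] (hgap : edgeGap G ⊥ p q ≤ ε) (hℓh : ℓ ≤ h) :
    edgeGap (binaryTree h) (φ.boundary hℓ) p' q ≤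
      (1 + (q - 1) * p' ^ (ℓ - 1)) ^ Nat.card G.edgeSet * ε := by
  classical
  obtain ⟨C, hC, hcomp⟩ := φ.exists_comparison hℓ hℓh hq hp0 hp1 hp
  let i₀ : G.edgeSet := Classical.arbitrary _
  have : Nonempty (binaryTree h).edgeSet := ⟨φ.leafEdge hℓ hℓh (i₀, true)⟩
  let τ : (binaryTree h).edgeSet → G.edgeSet :=
    fun e => if he : ∃ k, φ.leafEdge hℓ hℓh k = e then he.choose.1 else i₀
  have hτ : ∀ k, τ (φ.leafEdge hℓ hℓh k) = k.1 := by
    intro k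
    have he : ∃ k', φ.leafEdge hℓ hℓh k' = φ.leafEdge hℓ hℓh k := ⟨k, rfl⟩
    simp only [τ, dif_pos he]
    rw [φ.leafEdge_injective hℓ hℓh he.choose_spec]
  have hmem : ∀ e : (binaryTree h).edgeSet, ∀ A B : Config (binaryTree h), A \ {e} = B \ {e} →
      ∀ f ≠ e, (f ∈ A ↔ f ∈ B) := by
    intro e A B hAB f hf
    have := Set.ext_iff.1 hAB f
    simpa [hf] using this
  refine edgeGap_le_of_comparison G (binaryTree h) ⊥ (φ.boundary hℓ) hpp0 hpp1 hp0 hp1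
    (by linarith) (φ.project hℓ hℓh) (Finset.univ.image (φ.leafEdge hℓ hℓh)) τ ?_ ?_ ?_ ?_ C _ hC
    (fun η => (hcomp η).1) (fun η => ?_) ε hε hgap
  · intro i
    have h1 : (Finset.univ.image (φ.leafEdge hℓ hℓh)).filter (fun e => τ e = i) ⊆
        Finset.univ.image (fun b => φ.leafEdge hℓ hℓh (i, b)) := by
      intro e he
      obtain ⟨he, hi⟩ := Finset.mem_filter.1 he
      obtain ⟨⟨j, b⟩, -, rfl⟩ := Finset.mem_image.1 he
      rw [hτ] at hi
      exact Finset.mem_image.2 ⟨b, Finset.mem_univ b, by rw [← hi]⟩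
    exact (Finset.card_le_card h1).trans Finset.card_image_le
  · intro e he A B hAB
    obtain ⟨k, -, rfl⟩ := Finset.mem_image.1 he
    rw [hτ]
    ext i
    simp only [Set.mem_sdiff, Set.mem_singleton_iff, project, Set.mem_ofPred_eq]
    refine and_congr_left fun hi => forall_congr' fun b => hmem _ A B hAB _ fun h1 => hi ?_
    rw [← φ.leafEdge_injective hℓ hℓh h1]
  · intro e he A B hAB
    ext i
    simp only [project, Set.mem_ofPred_eq]
    exact forall_congr' fun b => hmem _ A B hAB _ fun h1 =>
      he (Finset.mem_image.2 ⟨_, Finset.mem_univ _, h1⟩)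
  · have h1 := Nat.card_le_card_of_injective _ (φ.leafEdge_injective hℓ hℓh)
    rw [Nat.card_prod, Nat.card_eq_fintype_card (α := Bool), Fintype.card_bool] at h1
    omega
  · rw [Nat.card_eq_fintype_card]
    exact (hcomp η).2

end TreeEmbedding

/-- Without edges the spectral gap is at least `1`. -/
theorem RandomCluster.one_le_edgeGap_of_isEmpty {V : Type*} [Fintype V] (G : SimpleGraph V)
    [IsEmpty G.edgeSet] (ξ : Setoid V) (p q : ℝ) : 1 ≤ edgeGap G ξ p q := by
  classical
  unfold edgeGap absoluteSpectralGap
  rw [le_sub_self_iff]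
  refine Real.sSup_nonpos ?_
  rintro r ⟨μ, hμ, -, rfl⟩
  obtain ⟨f, hf⟩ := hμ.exists_hasEigenvector
  have h1 : (edgeDynamics G ξ p q).mulVec f = μ • f := hf.apply_eq_smul
  -- The sum over edges is empty, so the transition matrix is `0` and so is every eigenvalue.
  have h2 : (edgeDynamics G ξ p q).mulVec f = 0 := by
    funext A
    rw [edgeDynamics_mulVec]
    simp
  rw [h2] at h1
  rw [(smul_eq_zero.1 h1.symm).resolve_right hf.2, abs_zero]

theorem theorem11 (q : ℝ) (hq : 2 < q) (c : ℝ) (hc : 0 < c) (γ : ℝ) (hγ : 0 < γ) :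
    ∃ δ : ℝ, 0 < δ ∧ ∃ c' : ℝ, 0 < c' ∧
      ∀ (V : Type*) [Fintype V] (G : SimpleGraph V) (p p' : ℝ) (h ℓ : ℕ) (hℓ : 0 < ℓ),
        0 < p → p < 1 →
        p = p' ^ 2 / (p' ^ 2 + 2 * p' * (1 - p') + (1 - p') ^ 2 * q) →
        RandomCluster.edgeGap G ⊥ p q ≤ Real.exp (-(c * Fintype.card V)) →
        Real.exp (-(γ * Fintype.card V)) ≤ p' → p' ≤ 1 / 2 →
        (Nat.card G.edgeSet : ℝ) * p' ^ (ℓ - 1) < δ * Fintype.card V →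
        ℓ ≤ h → Nat.card G.edgeSet < 2 ^ (h - ℓ) →
        Nonempty (TreeEmbedding G h ℓ) ∧
          ∀ φ : TreeEmbedding G h ℓ,
            RandomCluster.edgeGap (binaryTree h) (φ.boundary hℓ) p' q ≤
              Real.exp (-(c' * Fintype.card V)) := by
  have hq1 : 0 < q - 1 := by linarith
  -- The choice of `δ` gives `(q - 1) * |E| * p' ^ (ℓ - 1) ≤ c |V| / 2`, so the comparison factor
  -- consumes half of the exponent `c |V|` and `c' = c / 2` remains.
  refine ⟨c / (2 * (q - 1)), by positivity, c / 2, by positivity, ?_⟩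
  intro V _ G p p' h ℓ hℓ hp0 hp1 hp hgap hpγ hp2 hδ hℓh hcard
  refine ⟨TreeEmbedding.nonempty_of_card_lt G h ℓ hcard, fun φ => ?_⟩
  have hp'0 : 0 < p' := (Real.exp_pos _).trans_le hpγ
  -- The strict bound by `δ * |V|` rules out an empty vertex set.
  have hn : (0 : ℝ) < Fintype.card V := by
    have h1 : 0 ≤ (Nat.card G.edgeSet : ℝ) * p' ^ (ℓ - 1) := by positivity
    exact pos_of_mul_pos_right (h1.trans_lt hδ) (by positivity)
  have hε : Real.exp (-(c * Fintype.card V)) < 1 := by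
    rw [Real.exp_lt_one_iff]
    have := mul_pos hc hn
    linarith
  -- An edgeless graph has gap at least `1`, which contradicts the gap hypothesis.
  have hne : Nonempty G.edgeSet := by
    by_contra hempty
    rw [not_nonempty_iff] at hempty
    exact absurd (RandomCluster.one_le_edgeGap_of_isEmpty G ⊥ p q) (by linarith)
  refine (φ.edgeGap_le hℓ (by linarith) hp'0 (by linarith) hp0 hp1 hp _ hε hgap hℓh).trans ?_
  have h1 : (1 + (q - 1) * p' ^ (ℓ - 1)) ^ Nat.card G.edgeSet ≤
      Real.exp (c / 2 * Fintype.card V) := by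
    have h2 : 1 + (q - 1) * p' ^ (ℓ - 1) ≤ Real.exp ((q - 1) * p' ^ (ℓ - 1)) := by
      rw [add_comm]
      exact Real.add_one_le_exp _
    refine (pow_le_pow_left₀ (by positivity) h2 _).trans ?_
    rw [← Real.exp_nat_mul, Real.exp_le_exp]
    calc (Nat.card G.edgeSet : ℝ) * ((q - 1) * p' ^ (ℓ - 1))
        = (q - 1) * ((Nat.card G.edgeSet : ℝ) * p' ^ (ℓ - 1)) := by ring
      _ ≤ (q - 1) * (c / (2 * (q - 1)) * Fintype.card V) :=
          mul_le_mul_of_nonneg_left hδ.le hq1.le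
      _ = c / 2 * Fintype.card V := by field_simp
  calc _ ≤ Real.exp (c / 2 * Fintype.card V) * Real.exp (-(c * Fintype.card V)) :=
        mul_le_mul_of_nonneg_right h1 (Real.exp_pos _).le
    _ = Real.exp (-(c / 2 * Fintype.card V)) := by
        rw [← Real.exp_add]
        congr 1
        ring
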